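/- Let $\Omega$ be a separable metrizable topological space with Borel $\sigma$-algebra $\mathcal B(\Omega)$, and let $\mathcal L$ be a linear subspace of $C_b(\Omega)$ which contains the constants, is a vector lattice and generates the topology of $\Omega$. Let $c$ be a Prokhorov capacity on $\mathcal L$, that is, a seminorm $c:\mathcal L\to[0,\infty)$ such that * $c(f)\le c(g)$ whenever $f,g\in\mathcal L$ and $|f|\le|g|$; * $\inf_n c(f_n)=0$ for every sequence $(f_n)$ in $\mathcal L$ that decreases pointwise to $0$; * for every $\varepsilon>0$ there is a compact set $K\subset\Omega$ with $c(f)\le\varepsilon$ for all $f\in\mathcal L$ such that $|f|\le 1_{\Omega\setminus K}$. Extend $c$ by $c(f)=\sup\{c(\varphi):\varphi\in\mathcal L,\ 0\le\varphi\le f\}$ for lower semicontinuous $f:\Omega\to[0,\infty]$, and $c(g)=\inf\{c(f): f\ge|g|,\ f:\Omega\to[0,\infty]\text{ lower semicontinuous}\}$ for arbitrary $g:\Omega\to\mathbb R$. Let $\mathcal L^1(c)$ be the closure of $\mathcal L$ in $\{g:\Omega\to\mathbb R : c(g)<\infty\}$ for the seminorm $c$, and let $L^1(c)$ be the quotient of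 $\mathcal L^1(c)$ by the subspace $\{g : c(g)=0\}$, normed by $c$. For $X\in L^1(c)$ write $X\ge0$ if there are $f_n\in\mathcal L$, $f_n\ge0$, with $c(g-f_n)\to0$ for every $g$ in the class $X$; write $X\le Y$ if $Y-X\ge0$. A convex risk measure on $L^1(c)$ is a function $\rho:L^1(c)\to\mathbb R$ such that, for all $X,Y\in L^1(c)$, $\lambda\in[0,1]$ and $a\in\mathbb R$: $X\le Y$ implies $\rho(X)\ge\rho(Y)$; $\rho(\lambda X+(1-\lambda)Y)\le\lambda\rho(X)+(1-\lambda)\rho(Y)$; and $\rho(X+a)=\rho(X)-a$. A probability measure $Q$ on $(\Omega,\mathcal B(\Omega))$ belongs to $L^1(c)^*$ if every $f\in\mathcal L^1(c)$ is integrable with respect to (the completion of) $Q$ and $f\mapsto E_Q(f)=\int f\,dQ$ induces a continuous linear form on $L^1(c)$. For such $Q$ put $$\alpha(Q)=\sup_{X\in L^1(c)}\bigl(E_Q(-X)-\rho(X)\bigr)\in(-\infty,+\infty].$$ **Theorem.** For every convex risk measure $\rho$ on $L^1(c)$ there is a countable set $\{R_n : n\in\mathbb N\}$ of probability measures on $(\Omega,\mathcal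 B(\Omega))$ belonging to $L^1(c)^*$ such that $$\rho(X)=\sup_{n\in\mathbb N}\bigl(E_{R_n}(-X)-\alpha(R_n)\bigr)\qquad\text{for all }X\in L^1(c).$$ -/

import Mathlib

open Filter Topology MeasureTheory
open scoped ENNReal BoundedContinuousFunction

noncomputable section

namespace RiskCapacity

/-- A linear subspace of `C_b(Ω)` which contains the constants, is a vector lattice (for the
pointwise order) and generates the topology of `Ω`: the topology of `Ω` is the coarsest one for
which all elements of the subspace are continuous. -/
structure TestSpace (Ω : Type*) [t : TopologicalSpace Ω] where
  carrier : Submodule ℝ (Ω →ᵇ ℝ)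
  const_mem : ∀ a : ℝ, BoundedContinuousFunction.const Ω a ∈ carrier
  sup_mem : ∀ f ∈ carrier, ∀ g ∈ carrier, f ⊔ g ∈ carrier
  inf_mem : ∀ f ∈ carrier, ∀ g ∈ carrier, f ⊓ g ∈ carrier
  generates : t = ⨅ f ∈ carrier, TopologicalSpace.induced (fun ω => f ω) inferInstance

variable {Ω : Type*} [TopologicalSpace Ω] {𝓛 : TestSpace Ω}

/-- A capacity on `𝓛`: a monotone seminorm which is regular along sequences. -/
structure Capacity (𝓛 : TestSpace Ω) where
  toSeminorm : Seminorm ℝ 𝓛.carrier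
  mono : ∀ f g : 𝓛.carrier, (∀ ω, |f.1 ω| ≤ |g.1 ω|) → toSeminorm f ≤ toSeminorm g
  regular : ∀ f : ℕ → 𝓛.carrier, (∀ ω, Antitone fun n => (f n).1 ω) →
    (∀ ω, Tendsto (fun n => (f n).1 ω) atTop (𝓝 0)) →
    IsGLB (Set.range fun n => toSeminorm (f n)) 0

namespace Capacity

/-- Prokhorov capacities: for all `ε > 0` there is a compact set `K` with `c f ≤ ε` for all
`f ∈ 𝓛` such that `|f| ≤ 1_{Ω \ K}`. -/
def IsProkhorov (c : Capacity 𝓛) : Prop :=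
  ∀ ε : ℝ, 0 < ε → ∃ K : Set Ω, IsCompact K ∧
    ∀ f : 𝓛.carrier, (∀ ω, |f.1 ω| ≤ Kᶜ.indicator (fun _ => (1 : ℝ)) ω) → c.toSeminorm f ≤ ε

/-- `c(f) = sup {c(φ) | φ ∈ 𝓛, 0 ≤ φ ≤ f}`, for a lower semicontinuous `f : Ω → [0, ∞]`. -/
def lsc (c : Capacity 𝓛) (f : Ω → ℝ≥0∞) : ℝ≥0∞ :=
  ⨆ (φ : 𝓛.carrier) (_ : ∀ ω, 0 ≤ φ.1 ω ∧ ENNReal.ofReal (φ.1 ω) ≤ f ω),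
    ENNReal.ofReal (c.toSeminorm φ)

/-- `c(g) = inf {c(f) | f ≥ |g|, f lower semicontinuous with values in [0, ∞]}`, for an arbitrary
function `g : Ω → ℝ`. -/
def ext (c : Capacity 𝓛) (g : Ω → ℝ) : ℝ≥0∞ :=
  ⨅ (f : Ω → ℝ≥0∞) (_ : LowerSemicontinuous f ∧ ∀ ω, ENNReal.ofReal |g ω| ≤ f ω), c.lsc f

/-! ### The extended capacity is a seminorm -/

lemma ext_neg (c : Capacity 𝓛) (g : Ω → ℝ) : c.ext (-g) = c.ext g := by
  simp [ext]

lemma ext_coe_le (c : Capacity 𝓛) (φ : 𝓛.carrier) :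
    c.ext (fun ω => φ.1 ω) ≤ ENNReal.ofReal (c.toSeminorm φ) := by
  refine (iInf₂_le (fun ω => ENNReal.ofReal |φ.1 ω|) ⟨?_, fun ω => le_rfl⟩).trans ?_
  rotate_left
  · exact (ENNReal.continuous_ofReal.comp φ.1.continuous.abs).lowerSemicontinuous
  · refine iSup₂_le fun ψ hψ => ENNReal.ofReal_le_ofReal (c.mono _ _ fun ω => ?_)
    rw [abs_of_nonneg (hψ ω).1]
    exact (ENNReal.ofReal_le_ofReal_iff (abs_nonneg _)).1 (hψ ω).2

lemma ext_zero (c : Capacity 𝓛) : c.ext 0 = 0 := by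
  have h := c.ext_coe_le 0
  rw [map_zero, ENNReal.ofReal_zero] at h
  exact le_antisymm h zero_le

lemma ext_smul_le (c : Capacity 𝓛) (a : ℝ) (g : Ω → ℝ) :
    c.ext (a • g) ≤ ENNReal.ofReal |a| * c.ext g := by
  rcases eq_or_ne a 0 with rfl | ha
  · simp [ext_zero]
  have ha' : 0 < |a| := abs_pos.2 ha
  have h0 : ENNReal.ofReal |a| ≠ 0 := by simpa using ha
  unfold ext
  rw [ENNReal.mul_iInf_of_ne h0 ENNReal.ofReal_ne_top]
  refine le_iInf fun f => ?_
  rw [ENNReal.mul_iInf_of_ne h0 ENNReal.ofReal_ne_top]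
  refine le_iInf fun hf => ?_
  refine (iInf₂_le (fun ω => ENNReal.ofReal |a| * f ω) ⟨?_, fun ω => ?_⟩).trans ?_
  rotate_left
  · exact (ENNReal.continuous_const_mul ENNReal.ofReal_ne_top).comp_lowerSemicontinuous hf.1
      (fun x y h => by dsimp only; gcongr)
  · simp only [Pi.smul_apply, smul_eq_mul, abs_mul]
    rw [ENNReal.ofReal_mul (abs_nonneg a)]
    gcongr
    exact hf.2 ω
  · refine iSup₂_le fun ψ hψ => ?_
    have h1 : ENNReal.ofReal (c.toSeminorm (|a|⁻¹ • ψ)) ≤ c.lsc f := by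
      refine le_iSup₂_of_le (|a|⁻¹ • ψ) (fun ω => ?_) le_rfl
      have e : ((|a|⁻¹ • ψ : 𝓛.carrier) : Ω →ᵇ ℝ) ω = |a|⁻¹ * ψ.1 ω := rfl
      rw [e]
      refine ⟨mul_nonneg (inv_nonneg.2 ha'.le) (hψ ω).1, ?_⟩
      rw [ENNReal.ofReal_mul (inv_nonneg.2 ha'.le), ENNReal.ofReal_inv_of_pos ha']
      rw [ENNReal.inv_mul_le_iff h0 ENNReal.ofReal_ne_top]
      exact (hψ ω).2
    rw [map_smul_eq_mul, Real.norm_of_nonneg (inv_nonneg.2 ha'.le),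
      ENNReal.ofReal_mul (inv_nonneg.2 ha'.le), ENNReal.ofReal_inv_of_pos ha',
      ENNReal.inv_mul_le_iff h0 ENNReal.ofReal_ne_top] at h1
    exact h1

lemma exists_bump (𝓛 : TestSpace Ω) (x : Ω) (U : Set Ω) (hU : U ∈ 𝓝 x) :
    ∃ h ∈ 𝓛.carrier, (∀ y, 0 ≤ h y) ∧ 0 < h x ∧ ∀ y, 0 < h y → y ∈ U := by
  let F : Filter Ω :=
    { sets := {U | ∃ h ∈ 𝓛.carrier, (∀ y, 0 ≤ h y) ∧ 0 < h x ∧ ∀ y, 0 < h y → y ∈ U}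
      univ_sets := ⟨BoundedContinuousFunction.const Ω 1, 𝓛.const_mem 1, by simp, by simp, by simp⟩
      sets_of_superset := by
        rintro A B ⟨h, h1, h2, h3, h4⟩ hAB
        exact ⟨h, h1, h2, h3, fun y hy => hAB (h4 y hy)⟩
      inter_sets := by
        rintro A B ⟨h, h1, h2, h3, h4⟩ ⟨k, k1, k2, k3, k4⟩
        refine ⟨h ⊓ k, 𝓛.inf_mem _ h1 _ k1, fun y => le_inf (h2 y) (k2 y), lt_inf_iff.2 ⟨h3, k3⟩,
          fun y hy => ?_⟩
        have := lt_inf_iff.1 hy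
        exact ⟨h4 y this.1, k4 y this.2⟩ }
  suffices hF : F ≤ 𝓝 x from hF hU
  have e : 𝓝 x = ⨅ f ∈ 𝓛.carrier, comap (fun ω => f ω) (𝓝 (f x)) := by
    have := 𝓛.generates
    conv_lhs => rw [this]
    simp only [nhds_iInf, nhds_induced]
  rw [e]
  refine le_iInf₂ fun f hf => ?_
  rw [(Metric.nhds_basis_ball.comap _).ge_iff]
  intro ε hε
  have hd : f - BoundedContinuousFunction.const Ω (f x) ∈ 𝓛.carrier :=
    𝓛.carrier.sub_mem hf (𝓛.const_mem _)
  refine ⟨(BoundedContinuousFunction.const Ω ε -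
    ((f - BoundedContinuousFunction.const Ω (f x)) ⊔
      -(f - BoundedContinuousFunction.const Ω (f x)))) ⊔ BoundedContinuousFunction.const Ω 0,
    𝓛.sup_mem _ (𝓛.carrier.sub_mem (𝓛.const_mem _)
      (𝓛.sup_mem _ hd _ (𝓛.carrier.neg_mem hd))) _ (𝓛.const_mem 0), fun y => le_sup_right, ?_, ?_⟩
  · refine lt_sup_iff.2 (Or.inl ?_)
    simpa using hε
  · intro y hy
    rcases lt_sup_iff.1 hy with hy | hy
    · have h2 : max (f y - f x) (-(f y - f x)) < ε := by
        have : 0 < ε - max (f y - f x) (-(f y - f x)) := hy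
        linarith
      have h3 := max_lt_iff.1 h2
      rw [Set.mem_preimage, Metric.mem_ball, Real.dist_eq, abs_lt]
      constructor <;> linarith
    · simp at hy

/-- The test functions below `f`. -/
abbrev Below (𝓛 : TestSpace Ω) (f : Ω → ℝ≥0∞) : Type _ :=
  {u : 𝓛.carrier // ∀ ω, 0 ≤ u.1 ω ∧ ENNReal.ofReal (u.1 ω) ≤ f ω}

lemma exists_below (𝓛 : TestSpace Ω) {f : Ω → ℝ≥0∞} (hf : LowerSemicontinuous f) (x : Ω)
    (b : ℝ) (hb0 : 0 ≤ b) (hb : ENNReal.ofReal b < f x) :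
    ∃ u : 𝓛.carrier, (∀ ω, 0 ≤ u.1 ω ∧ ENNReal.ofReal (u.1 ω) ≤ f ω) ∧ b < u.1 x := by
  obtain ⟨r, hr0, hr1, hr2⟩ := ENNReal.lt_iff_exists_real_btwn.1 hb
  have hbr : b < r := (ENNReal.ofReal_lt_ofReal_iff_of_nonneg hb0).1 hr1
  obtain ⟨h, h1, h2, h3, h4⟩ := exists_bump 𝓛 x {y | ENNReal.ofReal r < f y} (hf x _ hr2)
  refine ⟨⟨((r / h x) • h) ⊓ BoundedContinuousFunction.const Ω r,
    𝓛.inf_mem _ (𝓛.carrier.smul_mem _ h1) _ (𝓛.const_mem r)⟩, fun y => ?_, ?_⟩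
  · have e : (((r / h x) • h) ⊓ BoundedContinuousFunction.const Ω r) y
      = min (r / h x * h y) r := rfl
    simp only [e]
    refine ⟨le_min (mul_nonneg (div_nonneg hr0 h3.le) (h2 y)) hr0, ?_⟩
    rcases (h2 y).eq_or_lt with hy | hy
    · rw [← hy, mul_zero, min_eq_left hr0]; simp
    · exact (ENNReal.ofReal_le_ofReal (min_le_right _ _)).trans (h4 y hy).le
  · have e : (((r / h x) • h) ⊓ BoundedContinuousFunction.const Ω r) x
      = min (r / h x * h x) r := rfl
    simp only [e]
    rw [div_mul_cancel₀ _ h3.ne', min_self]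
    exact hbr

lemma exists_seq_below [SecondCountableTopology Ω] (𝓛 : TestSpace Ω) {f : Ω → ℝ≥0∞}
    (hf : LowerSemicontinuous f) :
    ∃ u : ℕ → 𝓛.carrier, (∀ n ω, 0 ≤ (u n).1 ω ∧ ENNReal.ofReal ((u n).1 ω) ≤ f ω) ∧
      (∀ ω, Monotone fun n => (u n).1 ω) ∧
      ∀ (x : Ω) (b : ℝ), ENNReal.ofReal b < f x → ∃ n, b ≤ (u n).1 x := by
  have hT : ∀ q : ℚ, ∃ T : Set (Below 𝓛 f), T.Countable ∧
      ⋃ i ∈ T, {y | (q : ℝ) < i.1.1 y} = ⋃ i : Below 𝓛 f, {y | (q : ℝ) < i.1.1 y} := fun q =>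
    TopologicalSpace.isOpen_iUnion_countable _
      fun i => isOpen_lt continuous_const i.1.1.continuous
  choose T hTc hTe using hT
  let z : Below 𝓛 f := ⟨0, fun ω => ⟨le_rfl, by simp⟩⟩
  have hS : (insert z (⋃ q, T q)).Countable := (Set.countable_iUnion hTc).insert z
  obtain ⟨s, hs⟩ := hS.exists_eq_range ⟨z, Set.mem_insert _ _⟩
  let J : Below 𝓛 f → Below 𝓛 f → Below 𝓛 f := fun a b =>
    ⟨⟨a.1.1 ⊔ b.1.1, 𝓛.sup_mem _ a.1.2 _ b.1.2⟩, fun ω => ⟨le_sup_of_le_left (a.2 ω).1, by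
      rcases le_total (a.1.1 ω) (b.1.1 ω) with h | h
      · have e : (a.1.1 ⊔ b.1.1) ω = b.1.1 ω := max_eq_right h
        simp only [e]; exact (b.2 ω).2
      · have e : (a.1.1 ⊔ b.1.1) ω = a.1.1 ω := max_eq_left h
        simp only [e]; exact (a.2 ω).2⟩⟩
  let U : ℕ → Below 𝓛 f := fun n => Nat.rec (s 0) (fun n a => J a (s (n + 1))) n
  have hsU : ∀ n ω, (s n).1.1 ω ≤ (U n).1.1 ω := by
    intro n ω
    cases n with
    | zero => exact le_rfl
    | succ n => exact le_max_right _ _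
  refine ⟨fun n => (U n).1, fun n => (U n).2, fun ω => monotone_nat_of_le_succ fun n =>
    le_max_left _ _, fun x b hb => ?_⟩
  rcases le_or_gt b 0 with hb0 | hb0
  · exact ⟨0, hb0.trans ((U 0).2 x).1⟩
  obtain ⟨u, hu, hux⟩ := exists_below 𝓛 hf x b hb0.le hb
  obtain ⟨q, hq1, hq2⟩ := exists_rat_btwn hux
  have hx : x ∈ ⋃ i ∈ T q, {y | (q : ℝ) < i.1.1 y} := by
    rw [hTe]
    exact Set.mem_iUnion.2 ⟨⟨u, hu⟩, hq2⟩
  simp only [Set.mem_iUnion] at hx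
  obtain ⟨i, hi, hix⟩ := hx
  have hi' : i ∈ Set.range s := by
    rw [← hs]
    exact Set.mem_insert_of_mem _ (Set.mem_iUnion.2 ⟨q, hi⟩)
  obtain ⟨n, rfl⟩ := hi'
  exact ⟨n, (hq1.trans hix).le.trans (hsU n x)⟩

lemma lsc_add_le [SecondCountableTopology Ω] (c : Capacity 𝓛) {f g : Ω → ℝ≥0∞}
    (hf : LowerSemicontinuous f) (hg : LowerSemicontinuous g) :
    c.lsc (f + g) ≤ c.lsc f + c.lsc g := by
  refine iSup₂_le fun φ hφ => ?_
  obtain ⟨u, hu, hum, hus⟩ := exists_seq_below 𝓛 hf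
  obtain ⟨v, hv, hvm, hvs⟩ := exists_seq_below 𝓛 hg
  let w : ℕ → 𝓛.carrier := fun n =>
    ⟨(φ.1 - (u n).1 - (v n).1) ⊔ BoundedContinuousFunction.const Ω 0, 𝓛.sup_mem _
      (𝓛.carrier.sub_mem (𝓛.carrier.sub_mem φ.2 (u n).2) (v n).2) _ (𝓛.const_mem 0)⟩
  have hw : ∀ n ω, (w n).1 ω = max (φ.1 ω - (u n).1 ω - (v n).1 ω) 0 := fun n ω => rfl
  have hanti : ∀ ω, Antitone fun n => (w n).1 ω := by
    intro ω m n hmn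
    simp only [hw]
    exact max_le_max_right _ (by linarith [hum ω hmn, hvm ω hmn])
  have hlim : ∀ ω, Tendsto (fun n => (w n).1 ω) atTop (𝓝 0) := by
    intro ω
    rw [Metric.tendsto_atTop]
    intro ε hε
    have key : ∃ a b : ℝ, φ.1 ω - ε < a + b ∧ (a = 0 ∨ ENNReal.ofReal a < f ω) ∧
        (b = 0 ∨ ENNReal.ofReal b < g ω) := by
      have h1 := (hφ ω).2
      have h0 := (hφ ω).1
      have aux : ∀ (t : ℝ≥0∞), t ≠ ∞ → ∃ a : ℝ, t.toReal - ε / 3 ≤ a ∧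
          (a = 0 ∨ ENNReal.ofReal a < t) := by
        intro t ht
        rcases eq_or_ne t 0 with rfl | ht0
        · exact ⟨0, by simp; linarith, Or.inl rfl⟩
        · have := ENNReal.toReal_pos ht0 ht
          refine ⟨max (t.toReal - ε / 3) 0, le_max_left _ _, Or.inr ?_⟩
          rw [ENNReal.ofReal_lt_iff_lt_toReal (le_max_right _ _) ht]
          exact max_lt (by linarith) this
      by_cases hft : f ω = ∞
      · exact ⟨φ.1 ω, 0, by linarith, Or.inr (by simp [hft]), Or.inl rfl⟩
      by_cases hgt : g ω = ∞
      · exact ⟨0, φ.1 ω, by linarith, Or.inl rfl, Or.inr (by simp [hgt])⟩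
      obtain ⟨a, ha, ha'⟩ := aux _ hft
      obtain ⟨b, hb, hb'⟩ := aux _ hgt
      refine ⟨a, b, ?_, ha', hb'⟩
      have h2 : φ.1 ω ≤ (f ω).toReal + (g ω).toReal := by
        rw [← ENNReal.toReal_add hft hgt]
        exact (ENNReal.ofReal_le_iff_le_toReal (by simp [hft, hgt])).1 h1
      linarith
    obtain ⟨a, b, hab, ha, hb⟩ := key
    obtain ⟨n, hn⟩ : ∃ n, a ≤ (u n).1 ω := by
      rcases ha with rfl | ha
      · exact ⟨0, (hu 0 ω).1⟩
      · exact hus ω a ha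
    obtain ⟨m, hm⟩ : ∃ n, b ≤ (v n).1 ω := by
      rcases hb with rfl | hb
      · exact ⟨0, (hv 0 ω).1⟩
      · exact hvs ω b hb
    refine ⟨max n m, fun k hk => ?_⟩
    have hk1 := hum ω ((le_max_left n m).trans hk)
    have hk2 := hvm ω ((le_max_right n m).trans hk)
    dsimp only at hk1 hk2
    rw [Real.dist_eq, sub_zero, hw, abs_of_nonneg (le_max_right _ _)]
    exact max_lt (by linarith) hε
  have hglb := c.regular w hanti hlim
  refine ENNReal.le_of_forall_pos_le_add fun ε hε _ => ?_
  have : ∃ n, c.toSeminorm (w n) < ε := by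
    by_contra! hcon
    have := hglb.2 (show (ε : ℝ) ∈ lowerBounds _ by rintro _ ⟨n, rfl⟩; exact hcon n)
    have hε' : (0 : ℝ) < ε := hε
    linarith
  obtain ⟨n, hn⟩ := this
  have h1 : c.toSeminorm φ ≤ c.toSeminorm (u n) + c.toSeminorm (v n) + c.toSeminorm (w n) := by
    refine (c.mono φ (u n + v n + w n) fun ω => ?_).trans
      ((map_add_le_add _ _ _).trans (by gcongr; exact map_add_le_add _ _ _))
    have e : ((u n + v n + w n : 𝓛.carrier) : Ω →ᵇ ℝ) ω =
      (u n).1 ω + (v n).1 ω + max (φ.1 ω - (u n).1 ω - (v n).1 ω) 0 := rfl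
    rw [e, abs_of_nonneg (hφ ω).1]
    refine le_trans ?_ (le_abs_self _)
    linarith [le_max_left (φ.1 ω - (u n).1 ω - (v n).1 ω) 0]
  calc ENNReal.ofReal (c.toSeminorm φ)
      ≤ ENNReal.ofReal (c.toSeminorm (u n) + c.toSeminorm (v n) + c.toSeminorm (w n)) :=
        ENNReal.ofReal_le_ofReal h1
    _ ≤ ENNReal.ofReal (c.toSeminorm (u n)) + ENNReal.ofReal (c.toSeminorm (v n)) +
        ENNReal.ofReal (c.toSeminorm (w n)) :=
        ENNReal.ofReal_add_le.trans (by gcongr; exact ENNReal.ofReal_add_le)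
    _ ≤ c.lsc f + c.lsc g + ε := by
        gcongr
        · exact le_iSup₂_of_le (u n) (hu n) le_rfl
        · exact le_iSup₂_of_le (v n) (hv n) le_rfl
        · exact (ENNReal.ofReal_le_ofReal hn.le).trans (by simp)

lemma ext_add_le [TopologicalSpace.SeparableSpace Ω] [TopologicalSpace.MetrizableSpace Ω]
    (c : Capacity 𝓛) (g h : Ω → ℝ) : c.ext (g + h) ≤ c.ext g + c.ext h := by
  have : SecondCountableTopology Ω := by
    let _ := TopologicalSpace.metrizableSpaceMetric Ω
    exact UniformSpace.secondCountable_of_separable Ω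
  conv_rhs => unfold ext
  refine ENNReal.le_iInf₂_add_iInf₂ fun f hf k hk => ?_
  refine le_trans (iInf₂_le (f + k) ⟨hf.1.add hk.1, fun ω => ?_⟩) (c.lsc_add_le hf.1 hk.1)
  calc ENNReal.ofReal |g ω + h ω| ≤ ENNReal.ofReal (|g ω| + |h ω|) :=
        ENNReal.ofReal_le_ofReal (abs_add_le _ _)
    _ ≤ ENNReal.ofReal |g ω| + ENNReal.ofReal |h ω| := ENNReal.ofReal_add_le
    _ ≤ f ω + k ω := add_le_add (hf.2 ω) (hk.2 ω)

/-! ### The spaces `ℒ¹(c)` and `L¹(c)` -/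

section Spaces

variable [TopologicalSpace.SeparableSpace Ω] [TopologicalSpace.MetrizableSpace Ω]

/-- `ℒ¹(c)`: the closure of `𝓛` in `{g : Ω → ℝ | c(g) < ∞}` for the seminorm `c`. -/
def closureSubmodule (c : Capacity 𝓛) : Submodule ℝ (Ω → ℝ) where
  carrier := {g | c.ext g < ∞ ∧
    ∀ ε : ℝ≥0∞, 0 < ε → ∃ φ : 𝓛.carrier, c.ext (g - fun ω => φ.1 ω) < ε}
  zero_mem' := ⟨by simp [ext_zero], fun ε hε => ⟨0, by
    have e : ((0 : Ω → ℝ) - fun ω => ((0 : 𝓛.carrier) : Ω →ᵇ ℝ) ω) = 0 := by ext ω; simp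
    rw [e, ext_zero]; exact hε⟩⟩
  add_mem' := by
    rintro g h ⟨hg, hg'⟩ ⟨hh, hh'⟩
    refine ⟨(c.ext_add_le g h).trans_lt (ENNReal.add_lt_top.2 ⟨hg, hh⟩), fun ε hε => ?_⟩
    have hε2 : 0 < ε / 2 := ENNReal.half_pos hε.ne'
    obtain ⟨φ, hφ⟩ := hg' _ hε2
    obtain ⟨ψ, hψ⟩ := hh' _ hε2
    refine ⟨φ + ψ, ?_⟩
    have e : ((g + h) - fun ω => ((φ + ψ : 𝓛.carrier) : Ω →ᵇ ℝ) ω) =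
        (g - fun ω => φ.1 ω) + (h - fun ω => ψ.1 ω) := by
      ext ω; simp; ring
    rw [e, ← ENNReal.add_halves ε]
    exact (c.ext_add_le _ _).trans_lt (ENNReal.add_lt_add hφ hψ)
  smul_mem' := by
    rintro a g ⟨hg, hg'⟩
    refine ⟨(c.ext_smul_le a g).trans_lt (ENNReal.mul_lt_top ENNReal.ofReal_lt_top hg),
      fun ε hε => ?_⟩
    rcases eq_or_ne a 0 with rfl | ha
    · refine ⟨0, ?_⟩
      have e : (((0 : ℝ) • g) - fun ω => ((0 : 𝓛.carrier) : Ω →ᵇ ℝ) ω) = 0 := by ext ω; simp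
      rw [e, ext_zero]; exact hε
    have h0 : ENNReal.ofReal |a| ≠ 0 := by simpa using ha
    obtain ⟨φ, hφ⟩ := hg' (ε / ENNReal.ofReal |a|) (ENNReal.div_pos hε.ne' ENNReal.ofReal_ne_top)
    refine ⟨a • φ, ?_⟩
    have e : ((a • g) - fun ω => ((a • φ : 𝓛.carrier) : Ω →ᵇ ℝ) ω) =
        a • (g - fun ω => φ.1 ω) := by
      ext ω; simp; ring
    rw [e]
    refine (c.ext_smul_le _ _).trans_lt ?_
    rw [mul_comm]
    exact (ENNReal.lt_div_iff_mul_lt (Or.inl h0) (Or.inl ENNReal.ofReal_ne_top)).1 hφ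

/-- `ℒ¹(c)` as a type; its seminorm is `c`. -/
def CalL1 (c : Capacity 𝓛) : Type _ := c.closureSubmodule

instance (c : Capacity 𝓛) : AddCommGroup c.CalL1 :=
  inferInstanceAs (AddCommGroup c.closureSubmodule)

instance (c : Capacity 𝓛) : Module ℝ c.CalL1 :=
  inferInstanceAs (Module ℝ c.closureSubmodule)

instance (c : Capacity 𝓛) : CoeFun c.CalL1 fun _ => Ω → ℝ := ⟨fun g => g.1⟩

instance (c : Capacity 𝓛) : SeminormedAddCommGroup c.CalL1 :=
  AddGroupSeminorm.toSeminormedAddCommGroup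
    { toFun := fun g => (c.ext g).toReal
      map_zero' := by
        have : c.ext ((0 : c.CalL1) : Ω → ℝ) = 0 := c.ext_zero
        simp [this]
      add_le' := fun g h => by
        rw [← ENNReal.toReal_add g.2.1.ne h.2.1.ne]
        exact ENNReal.toReal_mono (by simp [g.2.1.ne, h.2.1.ne]) (c.ext_add_le g h)
      neg' := fun g => by
        have : c.ext ((-g : c.CalL1) : Ω → ℝ) = c.ext g := c.ext_neg g
        rw [this] }

instance (c : Capacity 𝓛) : NormedSpace ℝ c.CalL1 where
  norm_smul_le a g := by
    change (c.ext (a • (g : Ω → ℝ))).toReal ≤ ‖a‖ * (c.ext g).toReal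
    rw [Real.norm_eq_abs, ← ENNReal.toReal_ofReal (abs_nonneg a), ← ENNReal.toReal_mul]
    exact ENNReal.toReal_mono (ENNReal.mul_ne_top ENNReal.ofReal_ne_top g.2.1.ne)
      (c.ext_smul_le a g)

/-- `L¹(c)`: the quotient of `ℒ¹(c)` by the `c`-null elements, with the norm induced by `c`. -/
abbrev L1 (c : Capacity 𝓛) : Type _ := SeparationQuotient c.CalL1

/-- The class in `L¹(c)` of a function in `ℒ¹(c)`. -/
def toL1 (c : Capacity 𝓛) (g : c.CalL1) : c.L1 := SeparationQuotient.mk g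

/-- The elements of `𝓛` belong to `ℒ¹(c)`. -/
def ofTest (c : Capacity 𝓛) (φ : 𝓛.carrier) : c.CalL1 :=
  ⟨fun ω => φ.1 ω, (c.ext_coe_le φ).trans_lt ENNReal.ofReal_lt_top, fun ε hε => ⟨φ, by
    have e : ((fun ω => φ.1 ω) - fun ω => φ.1 ω) = (0 : Ω → ℝ) := sub_self _
    rw [e, ext_zero]; exact hε⟩⟩

/-- The class in `L¹(c)` of the constant function `a`. -/
def constL1 (c : Capacity 𝓛) (a : ℝ) : c.L1 :=
  c.toL1 (c.ofTest ⟨BoundedContinuousFunction.const Ω a, 𝓛.const_mem a⟩)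

/-- `X ≥ 0` in `L¹(c)`: there are `f n ∈ 𝓛`, `f n ≥ 0`, such that `c(g - f n) → 0` for every `g`
in the class `X`. -/
def IsNonneg (c : Capacity 𝓛) (X : c.L1) : Prop :=
  ∃ f : ℕ → 𝓛.carrier, (∀ n ω, 0 ≤ (f n).1 ω) ∧
    ∀ g : c.CalL1, c.toL1 g = X → Tendsto (fun n => c.ext (g - fun ω => (f n).1 ω)) atTop (𝓝 0)

/-- Convex risk measures on `L¹(c)`: monotone, convex and translation invariant functions. The
relation `X ≤ Y` on `L¹(c)` means `Y - X ≥ 0`. -/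
structure IsConvexRiskMeasure (c : Capacity 𝓛) (ρ : c.L1 → ℝ) : Prop where
  monotonic : ∀ X Y : c.L1, c.IsNonneg (Y - X) → ρ Y ≤ ρ X
  convex : ∀ (X Y : c.L1) (a : ℝ), 0 ≤ a → a ≤ 1 →
    ρ (a • X + (1 - a) • Y) ≤ a * ρ X + (1 - a) * ρ Y
  translation : ∀ (X : c.L1) (a : ℝ), ρ (X + c.constL1 a) = ρ X - a

variable [MeasurableSpace Ω]

/-- The measure `Q` belongs to `L¹(c)*`: all functions in `ℒ¹(c)` are `Q`-integrable (with respect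
to the completion of `Q`), and `f ↦ ∫ f dQ` induces a continuous linear form on `L¹(c)`. -/
def InDual (c : Capacity 𝓛) (Q : Measure Ω) : Prop :=
  (∀ f : c.CalL1, Integrable (fun ω => f ω) Q) ∧
    ∃ l : StrongDual ℝ c.L1, ∀ f : c.CalL1, l (c.toL1 f) = ∫ ω, f ω ∂Q

/-- `E_Q(X)`, the integral under `Q` of a representative of the class `X ∈ L¹(c)`. If `Q` belongs
to `L¹(c)*`, all representatives of `X` have the same integral, see `expect_toL1`. -/
def expect (c : Capacity 𝓛) (Q : Measure Ω) (X : c.L1) : ℝ :=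
  ∫ ω, (Quotient.out X : c.CalL1) ω ∂Q

lemma expect_toL1 (c : Capacity 𝓛) {Q : Measure Ω} (hQ : c.InDual Q) (f : c.CalL1) :
    c.expect Q (c.toL1 f) = ∫ ω, f ω ∂Q := by
  obtain ⟨-, l, hl⟩ := hQ
  rw [expect, ← hl, ← hl]
  exact congrArg l (Quotient.out_eq _)

/-- The Fenchel penalty `α(Q) = sup_{X ∈ L¹(c)} (E_Q(-X) - ρ(X))`, with values in `[-∞, ∞]`. -/
def penalty (c : Capacity 𝓛) (ρ : c.L1 → ℝ) (Q : Measure Ω) : EReal :=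
  ⨆ X : c.L1, ((c.expect Q (-X) - ρ X : ℝ) : EReal)

end Spaces

end Capacity

end RiskCapacity

end

/-!
A convex risk measure `ρ` on `L¹(c)` is the supremum of its affine minorants, and the three
hypotheses on `c` turn these minorants into countably many expectations.

*Continuity.* If `ρ` were unbounded above near the origin, there would be `X n` of rapidly
decreasing norm with `ρ (X n) > n`. The functions `|X n|` have a common upper bound `Y` in `L¹(c)`,
because the extended capacity is countably subadditive (`Capacity.ext_le_tsum`), and monotonicity
gives the contradiction `n < ρ (X n) ≤ ρ (-Y)`. A convex function that is bounded above near one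
point is continuous (`IsConvexRiskMeasure.continuous`).

*Subgradients are probability measures.* By Hahn–Banach, `ρ` has a subgradient `-q` at every point
(`exists_subgradient`). Monotonicity makes `q` positive and translation invariance makes
`q(1) = 1`. On the test functions `q` is σ-order continuous, because `c` is, so `q` is a Daniell
integral: `φ ↦ q(|φ|)` is again a capacity, its values on open sets generate a metric outer
measure, and the integral of the resulting Borel measure is `q`
(`Capacity.exists_measure_of_additive`). The bound `∫ |g| dQ ≤ ‖q‖ c(g)` carries the identity
over from test functions to `ℒ¹(c)` (`Capacity.exists_probabilityMeasure`).

*Countability.* If `c` is a Prokhorov capacity, a test function is determined up to a small error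
in `c` by its bound and its restriction to a compact metrizable set `K`, and `C(K, ℝ)` is separable;
hence `L¹(c)` is separable (`Capacity.separableSpace_L1`). Let `R n` be given by a subgradient
`-q n` at the points `x n` of a dense sequence. The minorant attached to `R n` has the value
`ρ (x n) - q n (X - x n)` at `X`, and the subgradient inequality at `2 x n - X` bounds it from
below by `2 ρ (x n) - ρ (2 x n - X)`, which tends to `ρ X` as `x n` tends to `X`.
-/

noncomputable section

namespace RiskCapacity

variable {Ω : Type*} [TopologicalSpace Ω] {𝓛 : TestSpace Ω}

/-! ### Operations on test functions -/

namespace TestSpace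

/-- The pointwise absolute value of a test function. -/
def absT (f : 𝓛.carrier) : 𝓛.carrier :=
  ⟨f.1 ⊔ -f.1, 𝓛.sup_mem _ f.2 _ (𝓛.carrier.neg_mem f.2)⟩

/-- The pointwise positive part of a test function. -/
def posT (f : 𝓛.carrier) : 𝓛.carrier :=
  ⟨f.1 ⊔ BoundedContinuousFunction.const Ω 0, 𝓛.sup_mem _ f.2 _ (𝓛.const_mem 0)⟩

/-- The pointwise minimum of a test function and a constant. -/
def minT (f : 𝓛.carrier) (a : ℝ) : 𝓛.carrier :=
  ⟨f.1 ⊓ BoundedContinuousFunction.const Ω a, 𝓛.inf_mem _ f.2 _ (𝓛.const_mem a)⟩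

/-- The pointwise truncation of a test function at the levels `-M` and `M`. -/
def truncT (f : 𝓛.carrier) (M : ℝ) : 𝓛.carrier :=
  ⟨(f.1 ⊓ BoundedContinuousFunction.const Ω M) ⊔ BoundedContinuousFunction.const Ω (-M),
    𝓛.sup_mem _ (𝓛.inf_mem _ f.2 _ (𝓛.const_mem M)) _ (𝓛.const_mem (-M))⟩

/-- A constant function as a test function. -/
def constT (𝓛 : TestSpace Ω) (a : ℝ) : 𝓛.carrier :=
  ⟨BoundedContinuousFunction.const Ω a, 𝓛.const_mem a⟩

@[simp] lemma absT_apply (f : 𝓛.carrier) (ω : Ω) : (absT f).1 ω = |f.1 ω| := rfl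

@[simp] lemma minT_apply (f : 𝓛.carrier) (a : ℝ) (ω : Ω) : (minT f a).1 ω = min (f.1 ω) a := rfl

lemma truncT_apply (f : 𝓛.carrier) (M : ℝ) (ω : Ω) :
    (truncT f M).1 ω = max (min (f.1 ω) M) (-M) := rfl

@[simp] lemma constT_apply (a : ℝ) (ω : Ω) : (constT 𝓛 a).1 ω = a := rfl

lemma ext_apply {f g : 𝓛.carrier} (h : ∀ ω, f.1 ω = g.1 ω) : f = g :=
  Subtype.ext (BoundedContinuousFunction.ext h)

end TestSpace

open TestSpace

lemma secondCountable_of_separable_metrizable (Ω : Type*) [TopologicalSpace Ω]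
    [TopologicalSpace.SeparableSpace Ω] [TopologicalSpace.MetrizableSpace Ω] :
    SecondCountableTopology Ω := by
  let _ := TopologicalSpace.metrizableSpaceMetric Ω
  exact UniformSpace.secondCountable_of_separable Ω

namespace Capacity

/-! ### Countable subadditivity of the extended capacity -/

lemma lsc_mono (c : Capacity 𝓛) {f g : Ω → ℝ≥0∞} (h : f ≤ g) : c.lsc f ≤ c.lsc g :=
  iSup₂_le fun φ hφ => le_iSup₂_of_le φ (fun ω => ⟨(hφ ω).1, (hφ ω).2.trans (h ω)⟩) le_rfl

lemma le_lsc (c : Capacity 𝓛) {f : Ω → ℝ≥0∞} (φ : 𝓛.carrier)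
    (h : ∀ ω, 0 ≤ φ.1 ω ∧ ENNReal.ofReal (φ.1 ω) ≤ f ω) :
    ENNReal.ofReal (c.toSeminorm φ) ≤ c.lsc f :=
  le_iSup₂_of_le φ h le_rfl

lemma lsc_zero (c : Capacity 𝓛) : c.lsc 0 = 0 := by
  refine le_antisymm (iSup₂_le fun φ hφ => ?_) zero_le
  have : φ = 0 := ext_apply fun ω => le_antisymm (by simpa using (hφ ω).2) (hφ ω).1
  simp [this]

lemma exists_toSeminorm_lt (c : Capacity 𝓛) {f : ℕ → 𝓛.carrier}
    (h1 : ∀ ω, Antitone fun n => (f n).1 ω)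
    (h2 : ∀ ω, Tendsto (fun n => (f n).1 ω) atTop (𝓝 0)) {ε : ℝ} (hε : 0 < ε) :
    ∃ n, c.toSeminorm (f n) < ε := by
  by_contra! hcon
  have := (c.regular f h1 h2).2 (show ε ∈ lowerBounds _ by rintro _ ⟨n, rfl⟩; exact hcon n)
  linarith

/-- Regularity along sequences makes the extended capacity continuous from below on lower
semicontinuous functions. -/
lemma lsc_iSup_le [SecondCountableTopology Ω] (c : Capacity 𝓛) {g : ℕ → Ω → ℝ≥0∞}
    (hg : ∀ n, LowerSemicontinuous (g n)) (hm : Monotone g) :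
    c.lsc (fun ω => ⨆ n, g n ω) ≤ ⨆ n, c.lsc (g n) := by
  refine iSup₂_le fun φ hφ => ?_
  choose u hu hum hus using fun n => exists_seq_below 𝓛 (hg n)
  -- `v n` is the maximum of `u i n` for `i ≤ n`; it increases to the supremum of the `g n`
  have hv : ∀ n, partialSups (fun i => (u i n).1) n ∈ 𝓛.carrier ∧
      ∀ ω, 0 ≤ partialSups (fun i => (u i n).1) n ω ∧
        ENNReal.ofReal (partialSups (fun i => (u i n).1) n ω) ≤ g n ω := by
    intro n
    rw [partialSups_apply]
    refine Finset.sup'_induction (p := fun h : Ω →ᵇ ℝ => h ∈ 𝓛.carrier ∧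
      ∀ ω, 0 ≤ h ω ∧ ENNReal.ofReal (h ω) ≤ g n ω) _ _ ?_ fun i hi => ⟨(u i n).2, fun ω =>
        ⟨(hu i n ω).1, (hu i n ω).2.trans (hm (Finset.mem_Iic.1 hi) ω)⟩⟩
    rintro a ⟨ha, ha'⟩ b ⟨hb, hb'⟩
    refine ⟨𝓛.sup_mem _ ha _ hb, fun ω => ⟨le_sup_of_le_left (ha' ω).1, ?_⟩⟩
    rw [BoundedContinuousFunction.coe_sup, Pi.sup_apply, ENNReal.ofReal_max]
    exact max_le (ha' ω).2 (hb' ω).2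
  let v : ℕ → 𝓛.carrier := fun n => ⟨_, (hv n).1⟩
  have hvm : ∀ ω, Monotone fun n => (v n).1 ω := by
    intro ω m n hmn
    have h1 : partialSups (fun i => (u i m).1) m ≤ partialSups (fun i => (u i n).1) n :=
      (partialSups_monotone _ hmn).trans (partialSups_mono (fun i ω => hum i ω hmn) n)
    exact h1 ω
  have hlim : ∀ ε : ℝ, 0 < ε → ∃ n, c.toSeminorm (posT (φ - v n)) < ε := by
    intro ε hε
    refine c.exists_toSeminorm_lt (fun ω m n hmn => ?_) (fun ω => ?_) hε
    · have := hvm ω hmn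
      change max (φ.1 ω - (v n).1 ω) 0 ≤ max (φ.1 ω - (v m).1 ω) 0
      exact max_le_max_right _ (by linarith)
    rw [Metric.tendsto_atTop]
    intro δ hδ
    obtain ⟨n, hn⟩ : ∃ n, φ.1 ω - δ / 2 ≤ (v n).1 ω := by
      rcases le_or_gt (φ.1 ω - δ / 2) 0 with h0 | h0
      · exact ⟨0, h0.trans ((hv 0).2 ω).1⟩
      · have h1 : ENNReal.ofReal (φ.1 ω - δ / 2) < ⨆ n, g n ω :=
          ((ENNReal.ofReal_lt_ofReal_iff (by linarith)).2 (by linarith)).trans_le (hφ ω).2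
        obtain ⟨n, hn⟩ := lt_iSup_iff.1 h1
        obtain ⟨k, hk⟩ := hus n ω _ hn
        refine ⟨max n k, hk.trans ((hum n ω (le_max_right n k)).trans ?_)⟩
        have h2 := le_partialSups_of_le (fun i => (u i (max n k)).1) (le_max_left n k)
        exact h2 ω
    refine ⟨n, fun m hm' => ?_⟩
    have h1 := hvm ω hm'
    dsimp only at h1
    have e : (posT (φ - v m)).1 ω = max (φ.1 ω - (v m).1 ω) 0 := rfl
    rw [Real.dist_eq, sub_zero, e, abs_of_nonneg (le_max_right _ _)]
    exact max_lt (by linarith) hδ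
  refine ENNReal.le_of_forall_pos_le_add fun ε hε _ => ?_
  obtain ⟨n, hn⟩ := hlim ε hε
  have h1 : c.toSeminorm φ ≤ c.toSeminorm (v n) + c.toSeminorm (posT (φ - v n)) := by
    refine (c.mono φ (v n + posT (φ - v n)) fun ω => ?_).trans (map_add_le_add _ _ _)
    have e : (v n + posT (φ - v n)).1 ω = (v n).1 ω + max (φ.1 ω - (v n).1 ω) 0 := rfl
    rw [e, abs_of_nonneg (hφ ω).1]
    refine le_trans ?_ (le_abs_self _)
    linarith [le_max_left (φ.1 ω - (v n).1 ω) 0]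
  calc ENNReal.ofReal (c.toSeminorm φ)
      ≤ ENNReal.ofReal (c.toSeminorm (v n)) + ENNReal.ofReal (c.toSeminorm (posT (φ - v n))) :=
        (ENNReal.ofReal_le_ofReal h1).trans ENNReal.ofReal_add_le
    _ ≤ (⨆ n, c.lsc (g n)) + ε := by
        gcongr
        · exact (c.le_lsc (v n) (hv n).2).trans (le_iSup (fun n => c.lsc (g n)) n)
        · exact (ENNReal.ofReal_le_ofReal hn.le).trans (by simp)

lemma lsc_tsum_le [SecondCountableTopology Ω] (c : Capacity 𝓛) {f : ℕ → Ω → ℝ≥0∞}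
    (hf : ∀ n, LowerSemicontinuous (f n)) :
    c.lsc (fun ω => ∑' n, f n ω) ≤ ∑' n, c.lsc (f n) := by
  have hs : ∀ n, LowerSemicontinuous (∑ i ∈ Finset.range n, f i) ∧
      c.lsc (∑ i ∈ Finset.range n, f i) ≤ ∑ i ∈ Finset.range n, c.lsc (f i) := by
    intro n
    induction n with
    | zero =>
      rw [Finset.sum_range_zero, Finset.sum_range_zero]
      exact ⟨lowerSemicontinuous_const, c.lsc_zero.le⟩
    | succ n ih =>
      rw [Finset.sum_range_succ, Finset.sum_range_succ]
      exact ⟨ih.1.add (hf n), (c.lsc_add_le ih.1 (hf n)).trans (by gcongr; exact ih.2)⟩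
  have e : (fun ω => ∑' n, f n ω) = fun ω => ⨆ n, (∑ i ∈ Finset.range n, f i) ω := by
    ext ω
    rw [ENNReal.tsum_eq_iSup_nat]
    simp
  rw [e]
  refine (c.lsc_iSup_le (fun n => (hs n).1) fun m n hmn => ?_).trans (iSup_le fun n => ?_)
  · exact Finset.sum_le_sum_of_subset (Finset.range_mono hmn)
  · exact (hs n).2.trans (ENNReal.sum_le_tsum _)

/-- On test functions the extended capacity is the original one. -/
lemma ext_coe (c : Capacity 𝓛) (φ : 𝓛.carrier) :
    c.ext (fun ω => φ.1 ω) = ENNReal.ofReal (c.toSeminorm φ) := by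
  refine le_antisymm (c.ext_coe_le φ) (le_iInf₂ fun f hf => ?_)
  refine le_trans (ENNReal.ofReal_le_ofReal (c.mono φ (absT φ) fun ω => by simp))
    (c.le_lsc (absT φ) fun ω => ⟨abs_nonneg _, hf.2 ω⟩)

lemma exists_lsc_lt (c : Capacity 𝓛) {g : Ω → ℝ} {a : ℝ≥0∞} (h : c.ext g < a) :
    ∃ f : Ω → ℝ≥0∞, LowerSemicontinuous f ∧ (∀ ω, ENNReal.ofReal |g ω| ≤ f ω) ∧ c.lsc f < a := by
  obtain ⟨f, hf⟩ := iInf_lt_iff.1 h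
  obtain ⟨h1, h2⟩ := iInf_lt_iff.1 hf
  exact ⟨f, h1.1, h1.2, h2⟩

lemma ext_le_lsc (c : Capacity 𝓛) {g : Ω → ℝ} {f : Ω → ℝ≥0∞} (hf : LowerSemicontinuous f)
    (h : ∀ ω, ENNReal.ofReal |g ω| ≤ f ω) : c.ext g ≤ c.lsc f :=
  iInf₂_le f ⟨hf, h⟩

lemma ext_mono (c : Capacity 𝓛) {g h : Ω → ℝ} (hgh : ∀ ω, |g ω| ≤ |h ω|) :
    c.ext g ≤ c.ext h :=
  le_iInf₂ fun _ hf => c.ext_le_lsc hf.1 fun ω =>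
    (ENNReal.ofReal_le_ofReal (hgh ω)).trans (hf.2 ω)

/-- The extended capacity is countably subadditive. -/
lemma ext_le_tsum [SecondCountableTopology Ω] (c : Capacity 𝓛) {g : Ω → ℝ} {f : ℕ → Ω → ℝ}
    (h : ∀ ω, ENNReal.ofReal |g ω| ≤ ∑' n, ENNReal.ofReal |f n ω|) :
    c.ext g ≤ ∑' n, c.ext (f n) := by
  refine ENNReal.le_of_forall_pos_le_add fun ε hε hfin => ?_
  obtain ⟨δ, hδ, hδs⟩ := ENNReal.exists_pos_sum_of_countable
    (ENNReal.coe_pos.2 hε).ne' ℕ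
  have h1 : ∀ n, c.ext (f n) < c.ext (f n) + δ n := fun n =>
    ENNReal.lt_add_right (ENNReal.ne_top_of_tsum_ne_top hfin.ne n)
      (ENNReal.coe_pos.2 (hδ n)).ne'
  choose k hk hkf hkl using fun n => c.exists_lsc_lt (h1 n)
  calc c.ext g ≤ c.lsc (fun ω => ∑' n, k n ω) :=
        c.ext_le_lsc (lowerSemicontinuous_tsum hk)
          fun ω => (h ω).trans (ENNReal.tsum_le_tsum fun n => hkf n ω)
    _ ≤ ∑' n, c.lsc (k n) := c.lsc_tsum_le hk
    _ ≤ ∑' n, (c.ext (f n) + δ n) := ENNReal.tsum_le_tsum fun n => (hkl n).le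
    _ = ∑' n, c.ext (f n) + ∑' n, (δ n : ℝ≥0∞) := ENNReal.tsum_add
    _ ≤ ∑' n, c.ext (f n) + ε := by gcongr

/-! ### The order of `L¹(c)` -/

section

variable [TopologicalSpace.SeparableSpace Ω] [TopologicalSpace.MetrizableSpace Ω]

lemma norm_def (c : Capacity 𝓛) (g : c.CalL1) : ‖g‖ = (c.ext g).toReal := rfl

lemma ofReal_norm (c : Capacity 𝓛) (g : c.CalL1) : ENNReal.ofReal ‖g‖ = c.ext g :=
  ENNReal.ofReal_toReal g.2.1.ne

lemma norm_toL1 (c : Capacity 𝓛) (g : c.CalL1) : ‖c.toL1 g‖ = ‖g‖ := rfl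

lemma norm_ofTest (c : Capacity 𝓛) (φ : 𝓛.carrier) : ‖c.ofTest φ‖ = c.toSeminorm φ := by
  rw [norm_def, ← ENNReal.toReal_ofReal (apply_nonneg c.toSeminorm φ), ← c.ext_coe φ]
  rfl

lemma exists_toL1 (c : Capacity 𝓛) (X : c.L1) : ∃ g : c.CalL1, c.toL1 g = X :=
  SeparationQuotient.surjective_mk X

lemma toL1_eq_iff (c : Capacity 𝓛) {g h : c.CalL1} : c.toL1 g = c.toL1 h ↔ c.ext (g - h) = 0 := by
  rw [toL1, toL1, SeparationQuotient.mk_eq_mk, Metric.inseparable_iff, dist_eq_norm]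
  exact (ENNReal.toReal_eq_zero_iff _).trans (or_iff_left (g - h).2.1.ne)

/-- `ℒ¹(c)` is closed under approximation in the extended capacity. -/
lemma mem_closureSubmodule_of_approx (c : Capacity 𝓛) {g : Ω → ℝ}
    (h : ∀ ε : ℝ≥0∞, 0 < ε → ∃ f : c.CalL1, c.ext (g - f) < ε) : g ∈ c.closureSubmodule := by
  refine ⟨?_, fun ε hε => ?_⟩
  · obtain ⟨f, hf⟩ := h 1 one_pos
    have e : g = (g - f) + f := by simp
    rw [e]
    exact (c.ext_add_le _ _).trans_lt
      (ENNReal.add_lt_top.2 ⟨hf.trans ENNReal.one_lt_top, f.2.1⟩)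
  · obtain ⟨f, hf⟩ := h _ (ENNReal.half_pos hε.ne')
    obtain ⟨φ, hφ⟩ := f.2.2 _ (ENNReal.half_pos hε.ne')
    refine ⟨φ, ?_⟩
    have e : (g - fun ω => φ.1 ω) = (g - f) + ((f : Ω → ℝ) - fun ω => φ.1 ω) := by simp
    rw [e, ← ENNReal.add_halves ε]
    exact (c.ext_add_le _ _).trans_lt (ENNReal.add_lt_add hf hφ)

/-- `ℒ¹(c)` is closed under absolute values. -/
lemma exists_abs (c : Capacity 𝓛) (g : c.CalL1) :
    ∃ h : c.CalL1, (∀ ω, h ω = |g ω|) ∧ ‖h‖ = ‖g‖ := by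
  have hm : (fun ω => |g ω|) ∈ c.closureSubmodule := by
    refine c.mem_closureSubmodule_of_approx fun ε hε => ?_
    obtain ⟨φ, hφ⟩ := g.2.2 ε hε
    exact ⟨c.ofTest (absT φ), (c.ext_mono fun ω => abs_abs_sub_abs_le _ _).trans_lt hφ⟩
  refine ⟨⟨_, hm⟩, fun ω => rfl, ?_⟩
  exact congrArg ENNReal.toReal (le_antisymm (c.ext_mono fun ω => (abs_abs _).le)
    (c.ext_mono fun ω => (abs_abs _).ge))

/-- The elements of `ℒ¹(c)` that can be approximated by nonnegative functions in `ℒ¹(c)` have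
nonnegative class. -/
lemma isNonneg_of_approx (c : Capacity 𝓛) (g : c.CalL1)
    (h : ∀ ε : ℝ≥0∞, 0 < ε → ∃ f : c.CalL1, (∀ ω, 0 ≤ f ω) ∧ c.ext (g - f) < ε) :
    c.IsNonneg (c.toL1 g) := by
  have key : ∀ ε : ℝ≥0∞, 0 < ε → ∃ φ : 𝓛.carrier, (∀ ω, 0 ≤ φ.1 ω) ∧
      c.ext (g - fun ω => φ.1 ω) < ε := by
    intro ε hε
    obtain ⟨f, hf0, hf⟩ := h _ (ENNReal.half_pos hε.ne')
    obtain ⟨φ, hφ⟩ := f.2.2 _ (ENNReal.half_pos hε.ne')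
    refine ⟨posT φ, fun ω => le_max_right _ _, ?_⟩
    have e : ((g : Ω → ℝ) - fun ω => (posT φ).1 ω) =
        ((g : Ω → ℝ) - f) + ((f : Ω → ℝ) - fun ω => (posT φ).1 ω) := by simp
    rw [e, ← ENNReal.add_halves ε]
    refine (c.ext_add_le _ _).trans_lt (ENNReal.add_lt_add hf (lt_of_le_of_lt ?_ hφ))
    refine c.ext_mono fun ω => ?_
    change |f ω - max (φ.1 ω) 0| ≤ |f ω - φ.1 ω|
    conv_lhs => rw [← max_eq_left (hf0 ω)]
    exact abs_max_sub_max_le_abs _ _ _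
  choose φ hφ0 hφ using fun n : ℕ => key ((n : ℝ≥0∞) + 1)⁻¹ (by simp)
  refine ⟨φ, hφ0, fun g' hg' => ?_⟩
  have h0 : c.ext (g' - g) = 0 := c.toL1_eq_iff.1 hg'
  have hle : ∀ n, c.ext (g' - fun ω => (φ n).1 ω) ≤ ((n : ℝ≥0∞) + 1)⁻¹ := by
    intro n
    have e : ((g' : Ω → ℝ) - fun ω => (φ n).1 ω) =
        ((g' : Ω → ℝ) - g) + ((g : Ω → ℝ) - fun ω => (φ n).1 ω) := by simp
    rw [e]
    refine (c.ext_add_le _ _).trans ?_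
    rw [h0, zero_add]
    exact (hφ n).le
  refine tendsto_of_tendsto_of_tendsto_of_le_of_le tendsto_const_nhds ?_ (fun _ => zero_le) hle
  have := (tendsto_add_atTop_iff_nat 1).2 ENNReal.tendsto_inv_nat_nhds_zero
  simpa using this

lemma isNonneg_toL1 (c : Capacity 𝓛) (g : c.CalL1) (h : ∀ ω, 0 ≤ g ω) :
    c.IsNonneg (c.toL1 g) :=
  c.isNonneg_of_approx g fun ε hε => ⟨g, h, by rw [sub_self, ext_zero]; exact hε⟩

/-- A sequence of nonnegative functions with summable norms has an upper bound in `L¹(c)`. The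
bound is the pointwise sum, with the value `0` where the sum is infinite. -/
lemma exists_upper_bound (c : Capacity 𝓛) (f : ℕ → c.CalL1) (h0 : ∀ n ω, 0 ≤ f n ω)
    (hs : ∑' n, c.ext (f n) ≠ ∞) :
    ∃ Y : c.CalL1, ∀ n, c.IsNonneg (c.toL1 (Y - f n)) := by
  have := secondCountable_of_separable_metrizable Ω
  let S : Ω → ℝ≥0∞ := fun ω => ∑' n, ENNReal.ofReal (f n ω)
  let s : ℕ → c.CalL1 := fun n => ∑ i ∈ Finset.range n, f i
  have hsω : ∀ n ω, s n ω = ∑ i ∈ Finset.range n, f i ω := by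
    intro n ω
    induction n with
    | zero => rfl
    | succ n ih =>
      rw [Finset.sum_range_succ, ← ih]
      change (∑ i ∈ Finset.range (n + 1), f i : c.CalL1) ω = _
      rw [Finset.sum_range_succ]
      rfl
  have htail : ∀ n, c.ext ((fun ω => (S ω).toReal) - s n) ≤ ∑' k, c.ext (f (k + n)) := by
    intro n
    refine c.ext_le_tsum fun ω => ?_
    have h1 : S ω = ENNReal.ofReal (s n ω) + ∑' k, ENNReal.ofReal (f (k + n) ω) := by
      rw [hsω, ENNReal.ofReal_sum_of_nonneg fun i _ => h0 i ω]
      exact (ENNReal.summable.sum_add_tsum_nat_add' ).symm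
    simp_rw [fun k => abs_of_nonneg (h0 (k + n) ω)]
    have hsn : 0 ≤ s n ω := by rw [hsω]; exact Finset.sum_nonneg fun i _ => h0 i ω
    by_cases hT : ∑' k, ENNReal.ofReal (f (k + n) ω) = ∞
    · rw [hT]; exact le_top
    · have e : ((fun ω => (S ω).toReal) - (s n : Ω → ℝ)) ω =
          (∑' k, ENNReal.ofReal (f (k + n) ω)).toReal := by
        change (S ω).toReal - s n ω = _
        rw [h1, ENNReal.toReal_add ENNReal.ofReal_ne_top hT, ENNReal.toReal_ofReal hsn]
        ring
      rw [e, abs_of_nonneg ENNReal.toReal_nonneg, ENNReal.ofReal_toReal hT]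
  have hlim := ENNReal.tendsto_sum_nat_add (fun n => c.ext (f n)) hs
  have happrox : ∀ (m : ℕ) (ε : ℝ≥0∞), 0 < ε → ∃ n, m ≤ n ∧
      c.ext ((fun ω => (S ω).toReal) - s n) < ε := by
    intro m ε hε
    obtain ⟨n, hn1, hn2⟩ := ((hlim.eventually_lt_const hε).and (eventually_ge_atTop m)).exists
    exact ⟨n, hn2, (htail n).trans_lt hn1⟩
  have hY : (fun ω => (S ω).toReal) ∈ c.closureSubmodule :=
    c.mem_closureSubmodule_of_approx fun ε hε => by
      obtain ⟨n, -, hn⟩ := happrox 0 ε hε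
      exact ⟨s n, hn⟩
  refine ⟨⟨_, hY⟩, fun n => c.isNonneg_of_approx _ fun ε hε => ?_⟩
  obtain ⟨m, hm, hm'⟩ := happrox (n + 1) ε hε
  refine ⟨s m - f n, fun ω => ?_, ?_⟩
  · change 0 ≤ s m ω - f n ω
    rw [hsω, sub_nonneg]
    exact Finset.single_le_sum (fun i _ => h0 i ω) (Finset.mem_range.2 hm)
  · refine lt_of_eq_of_lt (congrArg c.ext ?_) hm'
    ext ω
    change ((S ω).toReal - f n ω) - (s m ω - f n ω) = (S ω).toReal - s m ω
    ring

/-! ### Convex risk measures are continuous -/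

lemma IsConvexRiskMeasure.convexOn {c : Capacity 𝓛} {ρ : c.L1 → ℝ}
    (hρ : c.IsConvexRiskMeasure ρ) : ConvexOn ℝ Set.univ ρ := by
  refine ⟨convex_univ, fun X _ Y _ a b ha hb hab => ?_⟩
  obtain rfl : b = 1 - a := by linarith
  exact hρ.convex X Y a ha (by linarith)

/-- Monotonicity alone bounds a risk measure from above near the origin: otherwise there are
`X n` of rapidly decreasing norm with `ρ (X n) > n`, while all `-X n` lie below a common `Y`. -/
lemma IsConvexRiskMeasure.exists_bound {c : Capacity 𝓛} {ρ : c.L1 → ℝ}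
    (hρ : c.IsConvexRiskMeasure ρ) : ∃ r > 0, ∃ M : ℝ, ∀ X : c.L1, ‖X‖ < r → ρ X ≤ M := by
  by_contra! hcon
  choose X hX hXρ using fun n : ℕ => hcon ((1 / 2 : ℝ) ^ n) (by positivity) n
  choose g hg using fun n => c.exists_toL1 (X n)
  choose f hf hfn using fun n => c.exists_abs (g n)
  have hsum : ∑' n, c.ext (f n) ≠ ∞ := by
    have h1 : Summable fun n => ‖f n‖ := by
      refine Summable.of_nonneg_of_le (fun n => norm_nonneg _) (fun n => ?_)
        (summable_geometric_of_lt_one (by norm_num : (0 : ℝ) ≤ 1 / 2) (by norm_num))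
      rw [hfn, ← c.norm_toL1, hg]
      exact (hX n).le
    simp_rw [← c.ofReal_norm]
    exact h1.tsum_ofReal_ne_top
  obtain ⟨Y, hY⟩ := c.exists_upper_bound f (fun n ω => by rw [hf]; exact abs_nonneg _) hsum
  obtain ⟨n, hn⟩ := exists_nat_gt (ρ (-c.toL1 Y))
  have h1 : ρ (X n) ≤ ρ (-c.toL1 (f n)) := by
    refine hρ.monotonic _ _ ?_
    rw [← hg n, sub_neg_eq_add]
    refine c.isNonneg_toL1 (g n + f n) fun ω => ?_
    change 0 ≤ g n ω + f n ω
    rw [hf]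
    linarith [neg_abs_le (g n ω)]
  have h2 : ρ (-c.toL1 (f n)) ≤ ρ (-c.toL1 Y) := by
    refine hρ.monotonic _ _ ?_
    have e : -c.toL1 (f n) - -c.toL1 Y = c.toL1 Y - c.toL1 (f n) := by abel
    rw [e]
    exact hY n
  linarith [hXρ n]

lemma IsConvexRiskMeasure.continuous {c : Capacity 𝓛} {ρ : c.L1 → ℝ}
    (hρ : c.IsConvexRiskMeasure ρ) : Continuous ρ := by
  obtain ⟨r, hr, M, hM⟩ := hρ.exists_bound
  rw [← continuousOn_univ]
  have h := (hρ.convexOn.continuousOn_tfae isOpen_univ Set.univ_nonempty).out 3 1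
  refine h.1 ⟨0, Set.mem_univ _, M, ?_⟩
  rw [eventually_map]
  filter_upwards [Metric.ball_mem_nhds (0 : c.L1) hr] with X hX
  exact hM X (by simpa using hX)

end

end Capacity

/-! ### Subgradients -/

/-- A continuous convex function on a normed space has a subgradient at every point. -/
lemma exists_subgradient {E : Type*} [NormedAddCommGroup E] [NormedSpace ℝ E] {f : E → ℝ}
    (hf : ConvexOn ℝ Set.univ f) (hc : Continuous f) (x : E) :
    ∃ l : StrongDual ℝ E, ∀ y, f x + l (y - x) ≤ f y := by
  obtain ⟨F, hF⟩ := geometric_hahn_banach_open_point (x := (x, f x)) hf.convex_strict_epigraph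
    (by simpa using isOpen_lt (hc.comp continuous_fst) continuous_snd) (by simp)
  have hsplit : ∀ y t, F (y, t) = F (y, 0) + t * F (0, 1) := by
    intro y t
    rw [← smul_eq_mul, ← map_smul, ← map_add]
    simp
  have hb : F (0, 1) < 0 := by
    have := hF (x, f x + 1) (by simp)
    rw [hsplit, hsplit x (f x)] at this
    linarith
  refine ⟨(-F (0, 1))⁻¹ • F.comp (ContinuousLinearMap.inl ℝ E ℝ), fun y => ?_⟩
  have e : F (y - x, 0) = F (y, 0) - F (x, 0) := by
    rw [← map_sub]; simp
  simp only [smul_apply, ContinuousLinearMap.comp_apply,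
    ContinuousLinearMap.inl_apply, smul_eq_mul]
  refine le_of_forall_gt fun t ht => ?_
  have := hF (y, t) (by simpa using ht)
  rw [hsplit, hsplit x (f x)] at this
  rw [e, ← sub_pos]
  have h2 : 0 < (-F (0, 1)) * (t - (f x + (-F (0, 1))⁻¹ * (F (y, 0) - F (x, 0)))) := by
    have h3 : (-F (0, 1)) * ((-F (0, 1))⁻¹ * (F (y, 0) - F (x, 0))) = F (y, 0) - F (x, 0) :=
      mul_inv_cancel_left₀ (by linarith) _
    nlinarith
  exact pos_of_mul_pos_right h2 (by linarith)

namespace Capacity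

/-! ### Additive capacities are integrals -/

/-- The capacity of an open set: the extended capacity of its indicator function. -/
def openCap (c : Capacity 𝓛) (U : Set Ω) : ℝ≥0∞ := c.lsc (U.indicator 1)

lemma openCap_empty (c : Capacity 𝓛) : c.openCap ∅ = 0 := by
  rw [openCap, Set.indicator_empty]
  exact c.lsc_zero

lemma openCap_mono (c : Capacity 𝓛) {U V : Set Ω} (h : U ⊆ V) : c.openCap U ≤ c.openCap V :=
  c.lsc_mono (Set.indicator_le_indicator_of_subset h fun _ => zero_le)

lemma openCap_iUnion_le [SecondCountableTopology Ω] (c : Capacity 𝓛) (U : ℕ → Set Ω)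
    (hU : ∀ n, IsOpen (U n)) : c.openCap (⋃ n, U n) ≤ ∑' n, c.openCap (U n) := by
  refine le_trans (c.lsc_mono fun ω => ?_)
    (c.lsc_tsum_le fun n => (hU n).lowerSemicontinuous_indicator zero_le)
  by_cases h : ω ∈ ⋃ n, U n
  · obtain ⟨n, hn⟩ := Set.mem_iUnion.1 h
    refine le_trans ?_ (ENNReal.le_tsum n)
    rw [Set.indicator_of_mem h, Set.indicator_of_mem hn]
  · rw [Set.indicator_of_notMem h]
    exact zero_le

lemma openCap_univ (c : Capacity 𝓛) :
    c.openCap Set.univ = ENNReal.ofReal (c.toSeminorm (constT 𝓛 1)) := by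
  refine le_antisymm (iSup₂_le fun φ hφ => ENNReal.ofReal_le_ofReal (c.mono _ _ fun ω => ?_))
    (c.le_lsc _ fun ω => by simp)
  have := (hφ ω).2
  simp only [Set.indicator_univ, Pi.one_apply, ENNReal.ofReal_le_one] at this
  simpa [abs_of_nonneg (hφ ω).1] using this

/-- A capacity that is additive on nonnegative test functions is superadditive on disjoint
open sets. -/
lemma openCap_add_le (c : Capacity 𝓛)
    (hadd : ∀ φ ψ : 𝓛.carrier, (∀ ω, 0 ≤ φ.1 ω) → (∀ ω, 0 ≤ ψ.1 ω) →
      c.toSeminorm (φ + ψ) = c.toSeminorm φ + c.toSeminorm ψ)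
    {U V W : Set Ω} (hUV : Disjoint U V) (hU : U ⊆ W) (hV : V ⊆ W) :
    c.openCap U + c.openCap V ≤ c.openCap W := by
  refine ENNReal.biSup_add_biSup_le' (p := fun φ : 𝓛.carrier => ∀ ω, 0 ≤ φ.1 ω ∧
      ENNReal.ofReal (φ.1 ω) ≤ U.indicator 1 ω) (q := fun φ : 𝓛.carrier => ∀ ω, 0 ≤ φ.1 ω ∧
      ENNReal.ofReal (φ.1 ω) ≤ V.indicator 1 ω) ⟨0, fun ω => ⟨le_rfl, by simp⟩⟩
      ⟨0, fun ω => ⟨le_rfl, by simp⟩⟩ fun φ hφ ψ hψ => ?_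
  rw [← ENNReal.ofReal_add (apply_nonneg _ _) (apply_nonneg _ _),
    ← hadd φ ψ (fun ω => (hφ ω).1) (fun ω => (hψ ω).1)]
  refine c.le_lsc _ fun ω => ⟨add_nonneg (hφ ω).1 (hψ ω).1, ?_⟩
  have e : (φ + ψ).1 ω = φ.1 ω + ψ.1 ω := rfl
  rw [e, ENNReal.ofReal_add (hφ ω).1 (hψ ω).1]
  refine (add_le_add (hφ ω).2 (hψ ω).2).trans ?_
  rw [← congrFun (Set.indicator_union_of_disjoint hUV 1) ω]
  exact Set.indicator_le_indicator_of_subset (Set.union_subset hU hV) (fun _ => zero_le) ω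

/-- An additive capacity on the open sets is the restriction of a Borel measure. By Carathéodory's
criterion for metric outer measures it suffices to add the capacities of sets at positive
distance, and these have disjoint open neighbourhoods. -/
lemma exists_measure_openCap [TopologicalSpace.SeparableSpace Ω]
    [TopologicalSpace.MetrizableSpace Ω] [MeasurableSpace Ω] [BorelSpace Ω] (c : Capacity 𝓛)
    (hadd : ∀ φ ψ : 𝓛.carrier, (∀ ω, 0 ≤ φ.1 ω) → (∀ ω, 0 ≤ ψ.1 ω) →
      c.toSeminorm (φ + ψ) = c.toSeminorm φ + c.toSeminorm ψ) :
    ∃ μ : Measure Ω, ∀ U, IsOpen U → μ U = c.openCap U := by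
  have := secondCountable_of_separable_metrizable Ω
  let _ := TopologicalSpace.metrizableSpaceMetric Ω
  have hU : ∀ ⦃f : ℕ → Set Ω⦄, (∀ i, IsOpen (f i)) → IsOpen (⋃ i, f i) := fun f h => isOpen_iUnion h
  have hsU : ∀ ⦃f : ℕ → Set Ω⦄, (∀ i, IsOpen (f i)) →
      c.openCap (⋃ i, f i) ≤ ∑' i, c.openCap (f i) := fun f h => c.openCap_iUnion_le f h
  let O : OuterMeasure Ω := inducedOuterMeasure (fun U (_ : IsOpen U) => c.openCap U)
    isOpen_empty c.openCap_empty
  have hO : ∀ U, IsOpen U → O U = c.openCap U := fun U h =>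
    inducedOuterMeasure_eq' hU hsU (fun _ _ _ _ h => c.openCap_mono h) h
  have hOinf : ∀ s, O s = ⨅ (U : Set Ω) (_ : IsOpen U) (_ : s ⊆ U), c.openCap U := fun s =>
    inducedOuterMeasure_eq_iInf hU hsU (fun _ _ _ _ h => c.openCap_mono h) s
  have hmet : O.IsMetric := by
    rintro s t ⟨r, hr, hst⟩
    refine le_antisymm (measure_union_le _ _) ?_
    rw [hOinf (s ∪ t)]
    refine le_iInf₂ fun W hW => le_iInf fun hsW => ?_
    let N : Set Ω → Set Ω := fun s => ⋃ x ∈ s, {y | edist y x < r / 2}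
    have hN : ∀ s, IsOpen (N s) := fun s =>
      isOpen_biUnion fun x _ => isOpen_lt (by fun_prop) continuous_const
    have hsN : ∀ s, s ⊆ N s := fun s x hx =>
      Set.mem_iUnion₂.2 ⟨x, hx, by simpa [pos_iff_ne_zero] using hr⟩
    have hdisj : Disjoint (W ∩ N s) (W ∩ N t) := by
      refine Set.disjoint_left.2 fun z hz hz' => ?_
      obtain ⟨x, hx, hzx⟩ := Set.mem_iUnion₂.1 hz.2
      obtain ⟨y, hy, hzy⟩ := Set.mem_iUnion₂.1 hz'.2
      refine absurd (hst x hx y hy) (not_le.2 ?_)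
      calc edist x y ≤ edist z x + edist z y := edist_triangle_left _ _ _
        _ < r / 2 + r / 2 := ENNReal.add_lt_add hzx hzy
        _ = r := ENNReal.add_halves r
    calc O s + O t ≤ O (W ∩ N s) + O (W ∩ N t) := by
          gcongr
          · exact Set.subset_inter (Set.subset_union_left.trans hsW) (hsN s)
          · exact Set.subset_inter (Set.subset_union_right.trans hsW) (hsN t)
      _ ≤ c.openCap W := by
          rw [hO _ (hW.inter (hN s)), hO _ (hW.inter (hN t))]
          exact c.openCap_add_le hadd hdisj Set.inter_subset_left Set.inter_subset_left
  refine ⟨O.toMeasure hmet.le_caratheodory, fun U h => ?_⟩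
  rw [toMeasure_apply _ _ h.measurableSet, hO U h]

lemma integrable_test [MeasurableSpace Ω] [BorelSpace Ω] (μ : Measure Ω) [IsFiniteMeasure μ]
    (φ : 𝓛.carrier) : Integrable (fun ω => φ.1 ω) μ := by
  refine Integrable.of_bound φ.1.continuous.measurable.aestronglyMeasurable ‖φ.1‖
    (Eventually.of_forall fun ω => φ.1.norm_coe_le_norm ω)

/-- Half of the representation of an additive capacity: cut `φ` into slices of height `δ` and
compare each slice with the next lower one through the measure of the level set between them. -/
lemma toSeminorm_le_integral [MeasurableSpace Ω] [BorelSpace Ω] (c : Capacity 𝓛) (μ : Measure Ω)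
    [IsFiniteMeasure μ] (hμ : ∀ U, IsOpen U → μ U = c.openCap U) (φ : 𝓛.carrier)
    (hφ : ∀ ω, 0 ≤ φ.1 ω) : c.toSeminorm φ ≤ ∫ ω, φ.1 ω ∂μ := by
  refine le_of_forall_pos_le_add fun ε hε => ?_
  obtain ⟨δ, hδ, hδε⟩ : ∃ δ : ℝ, 0 < δ ∧ δ * c.toSeminorm (constT 𝓛 1) ≤ ε := by
    have h0 := apply_nonneg c.toSeminorm (constT 𝓛 1)
    refine ⟨ε / (c.toSeminorm (constT 𝓛 1) + 1), by positivity, ?_⟩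
    rw [div_mul_eq_mul_div, div_le_iff₀ (by positivity)]
    nlinarith
  let s : ℕ → 𝓛.carrier := fun m => minT φ ((m + 1 : ℕ) * δ) - minT φ (m * δ)
  have hsω : ∀ m ω, (s m).1 ω = min (φ.1 ω) ((m + 1) * δ) - min (φ.1 ω) (m * δ) := by
    intro m ω
    have : (s m).1 ω = min (φ.1 ω) ((m + 1 : ℕ) * δ) - min (φ.1 ω) (m * δ) := rfl
    simpa using this
  have hs0 : ∀ m ω, 0 ≤ (s m).1 ω := by
    intro m ω
    rw [hsω, sub_nonneg]
    exact min_le_min_left _ (by nlinarith)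
  have hstep : ∀ m, c.toSeminorm (s (m + 1)) ≤ ∫ ω, (s m).1 ω ∂μ := by
    intro m
    have hopen : IsOpen {ω | (m + 1) * δ < φ.1 ω} := isOpen_lt continuous_const φ.1.continuous
    have h1 : δ⁻¹ * c.toSeminorm (s (m + 1)) ≤ μ.real {ω | (m + 1) * δ < φ.1 ω} := by
      rw [Measure.real, hμ _ hopen, ← ENNReal.ofReal_le_iff_le_toReal (by
        rw [← hμ _ hopen]; exact measure_ne_top _ _)]
      have e : δ⁻¹ * c.toSeminorm (s (m + 1)) = c.toSeminorm (δ⁻¹ • s (m + 1)) := by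
        rw [map_smul_eq_mul, Real.norm_of_nonneg (by positivity)]
      rw [e]
      refine c.le_lsc _ fun ω => ?_
      have e2 : (δ⁻¹ • s (m + 1)).1 ω = δ⁻¹ * (s (m + 1)).1 ω := rfl
      rw [e2]
      refine ⟨mul_nonneg (by positivity) (hs0 _ ω), ?_⟩
      rw [hsω]
      push_cast
      by_cases h : ω ∈ {ω | (m + 1) * δ < φ.1 ω}
      · rw [Set.indicator_of_mem h, Pi.one_apply, ENNReal.ofReal_le_one,
          inv_mul_le_iff₀ hδ, min_eq_right (a := φ.1 ω) (b := (m + 1) * δ) (le_of_lt h)]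
        linarith [min_le_right (φ.1 ω) ((m + 1 + 1) * δ)]
      · have h' : φ.1 ω ≤ (m + 1) * δ := not_lt.1 h
        rw [min_eq_left h', min_eq_left (h'.trans (by nlinarith))]
        simp
    have h2 : δ * μ.real {ω | δ ≤ (s m).1 ω} ≤ ∫ ω, (s m).1 ω ∂μ :=
      mul_meas_ge_le_integral_of_nonneg (Eventually.of_forall (hs0 m)) (integrable_test μ _) δ
    have h3 : μ.real {ω | (m + 1) * δ < φ.1 ω} ≤ μ.real {ω | δ ≤ (s m).1 ω} := by
      refine measureReal_mono fun ω hω => ?_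
      change δ ≤ (s m).1 ω
      have hω' : (m + 1) * δ < φ.1 ω := hω
      rw [hsω, min_eq_right hω'.le, min_eq_right (by nlinarith)]
      linarith
    rw [inv_mul_le_iff₀ hδ] at h1
    exact h1.trans ((mul_le_mul_of_nonneg_left h3 hδ.le).trans h2)
  have hind : ∀ m : ℕ, c.toSeminorm (minT φ ((m + 1 : ℕ) * δ)) ≤
      δ * c.toSeminorm (constT 𝓛 1) + ∫ ω, (minT φ (m * δ)).1 ω ∂μ := by
    intro m
    induction m with
    | zero =>
      have h1 : c.toSeminorm (minT φ ((0 + 1 : ℕ) * δ)) ≤ c.toSeminorm (δ • constT 𝓛 1) := by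
        refine c.mono _ _ fun ω => ?_
        have e : (δ • constT 𝓛 1).1 ω = δ * 1 := rfl
        rw [e, minT_apply, abs_of_nonneg (le_min (hφ ω) (by positivity)), mul_one,
          abs_of_pos hδ]
        simp
      rw [map_smul_eq_mul, Real.norm_of_nonneg hδ.le] at h1
      have h2 : ∫ ω, (minT φ ((0 : ℕ) * δ)).1 ω ∂μ = 0 := by
        simp [hφ]
      rw [h2, add_zero]
      exact h1
    | succ m ih =>
      have e1 : minT φ ((m + 1 + 1 : ℕ) * δ) = minT φ ((m + 1 : ℕ) * δ) + s (m + 1) :=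
        ext_apply fun ω => (add_sub_cancel ((minT φ ((m + 1 : ℕ) * δ)).1 ω) _).symm
      have e2 : ∫ ω, (minT φ ((m + 1 : ℕ) * δ)).1 ω ∂μ =
          ∫ ω, (minT φ (m * δ)).1 ω ∂μ + ∫ ω, (s m).1 ω ∂μ := by
        rw [← integral_add (integrable_test μ _) (integrable_test μ _)]
        refine integral_congr_ae (Eventually.of_forall fun ω => ?_)
        change (minT φ ((m + 1 : ℕ) * δ)).1 ω =
          (minT φ (m * δ)).1 ω + ((minT φ ((m + 1 : ℕ) * δ)).1 ω - (minT φ (m * δ)).1 ω)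
        ring
      rw [e1, e2]
      exact (map_add_le_add _ _ _).trans (by linarith [hstep m])
  obtain ⟨m, hm⟩ := exists_nat_gt (‖φ.1‖ / δ)
  rw [div_lt_iff₀ hδ] at hm
  have hle : ∀ ω, φ.1 ω ≤ m * δ := fun ω =>
    (le_abs_self _).trans ((φ.1.norm_coe_le_norm ω).trans hm.le)
  have e1 : minT φ ((m + 1 : ℕ) * δ) = φ := ext_apply fun ω =>
    min_eq_left (b := (m + 1 : ℕ) * δ) ((hle ω).trans (by push_cast; nlinarith))
  have e2 : minT φ (m * δ) = φ := ext_apply fun ω => min_eq_left (hle ω)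
  have := hind m
  rw [e1, e2] at this
  linarith

/-- Daniell's representation theorem: a capacity that is additive on nonnegative test functions is
the integral with respect to a finite Borel measure. -/
theorem exists_measure_of_additive [TopologicalSpace.SeparableSpace Ω]
    [TopologicalSpace.MetrizableSpace Ω] [MeasurableSpace Ω] [BorelSpace Ω] (c : Capacity 𝓛)
    (hadd : ∀ φ ψ : 𝓛.carrier, (∀ ω, 0 ≤ φ.1 ω) → (∀ ω, 0 ≤ ψ.1 ω) →
      c.toSeminorm (φ + ψ) = c.toSeminorm φ + c.toSeminorm ψ) :
    ∃ μ : Measure Ω, IsFiniteMeasure μ ∧ ∀ φ : 𝓛.carrier, (∀ ω, 0 ≤ φ.1 ω) →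
      ∫ ω, φ.1 ω ∂μ = c.toSeminorm φ := by
  obtain ⟨μ, hμ⟩ := c.exists_measure_openCap hadd
  have huniv : μ Set.univ = ENNReal.ofReal (c.toSeminorm (constT 𝓛 1)) := by
    rw [hμ _ isOpen_univ, openCap_univ]
  have hfin : IsFiniteMeasure μ := ⟨by rw [huniv]; exact ENNReal.ofReal_lt_top⟩
  refine ⟨μ, hfin, fun φ hφ => le_antisymm ?_ (c.toSeminorm_le_integral μ hμ φ hφ)⟩
  -- the reverse inequality for `φ` is the inequality already known for `M - φ`
  have hM0 := norm_nonneg φ.1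
  set M := ‖φ.1‖
  have hψ : ∀ ω, 0 ≤ (constT 𝓛 M - φ).1 ω := fun ω =>
    sub_nonneg.2 ((le_abs_self _).trans (φ.1.norm_coe_le_norm ω))
  have h1 := c.toSeminorm_le_integral μ hμ _ hψ
  have h2 := hadd _ _ hφ hψ
  have e0 : φ + (constT 𝓛 M - φ) = constT 𝓛 M := ext_apply fun ω => add_sub_cancel (φ.1 ω) M
  rw [e0] at h2
  have e : constT 𝓛 M = M • constT 𝓛 1 := ext_apply fun ω => (mul_one M).symm
  have h3 : c.toSeminorm (constT 𝓛 M) = M * c.toSeminorm (constT 𝓛 1) := by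
    rw [e, map_smul_eq_mul, Real.norm_of_nonneg hM0]
  have h4 : ∫ ω, (constT 𝓛 M - φ).1 ω ∂μ = M * c.toSeminorm (constT 𝓛 1) - ∫ ω, φ.1 ω ∂μ := by
    have h5 : ∫ ω, (constT 𝓛 M - φ).1 ω ∂μ = ∫ ω, (M - φ.1 ω) ∂μ := rfl
    rw [h5, integral_sub (integrable_const _) (integrable_test μ φ), integral_const, Measure.real,
      huniv, ENNReal.toReal_ofReal (apply_nonneg _ _), smul_eq_mul, mul_comm]
  linarith

section

variable [TopologicalSpace.SeparableSpace Ω] [TopologicalSpace.MetrizableSpace Ω]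

/-! ### Positive continuous linear forms on `L¹(c)` -/

/-- The linear map that sends a test function to its class in `L¹(c)`. -/
def testMap (c : Capacity 𝓛) : 𝓛.carrier →ₗ[ℝ] c.L1 where
  toFun φ := c.toL1 (c.ofTest φ)
  map_add' _ _ := rfl
  map_smul' _ _ := rfl

lemma testMap_apply (c : Capacity 𝓛) (φ : 𝓛.carrier) : c.testMap φ = c.toL1 (c.ofTest φ) := rfl

lemma testMap_sub (c : Capacity 𝓛) (φ ψ : 𝓛.carrier) :
    c.testMap (φ - ψ) = c.testMap φ - c.testMap ψ := rfl

lemma norm_testMap (c : Capacity 𝓛) (φ : 𝓛.carrier) : ‖c.testMap φ‖ = c.toSeminorm φ :=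
  (c.norm_toL1 _).trans (c.norm_ofTest φ)

lemma toL1_sub (c : Capacity 𝓛) (f g : c.CalL1) : c.toL1 (f - g) = c.toL1 f - c.toL1 g := rfl

lemma abs_apply_testMap_le (c : Capacity 𝓛) (q : StrongDual ℝ c.L1) (φ : 𝓛.carrier) :
    |q (c.testMap φ)| ≤ ‖q‖ * c.toSeminorm φ := by
  rw [← norm_testMap]
  exact q.le_opNorm _

lemma apply_testMap_mono {c : Capacity 𝓛} {q : StrongDual ℝ c.L1}
    (hq : ∀ φ : 𝓛.carrier, (∀ ω, 0 ≤ φ.1 ω) → 0 ≤ q (c.testMap φ)) {φ ψ : 𝓛.carrier}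
    (h : ∀ ω, φ.1 ω ≤ ψ.1 ω) : q (c.testMap φ) ≤ q (c.testMap ψ) := by
  have := hq (ψ - φ) fun ω => sub_nonneg.2 (h ω)
  rwa [testMap_sub, map_sub, sub_nonneg] at this

/-- The capacity `φ ↦ q(|φ|)` attached to a positive continuous linear form `q` on `L¹(c)`. -/
def ofPositive (c : Capacity 𝓛) (q : StrongDual ℝ c.L1)
    (hq : ∀ φ : 𝓛.carrier, (∀ ω, 0 ≤ φ.1 ω) → 0 ≤ q (c.testMap φ)) : Capacity 𝓛 where
  toSeminorm := Seminorm.of (fun φ => q (c.testMap (absT φ)))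
    (fun φ ψ => by
      rw [← map_add, ← map_add]
      exact apply_testMap_mono hq fun ω => abs_add_le _ _)
    (fun a φ => by
      have e : absT (a • φ) = ‖a‖ • absT φ := ext_apply fun ω => abs_mul a (φ.1 ω)
      rw [e, map_smul, map_smul, smul_eq_mul])
  mono f g h := apply_testMap_mono hq h
  regular f h1 h2 := by
    refine ⟨?_, fun b hb => le_of_forall_pos_lt_add fun ε hε => ?_⟩
    · rintro _ ⟨n, rfl⟩
      exact hq _ fun ω => abs_nonneg _
    · obtain ⟨n, hn⟩ := c.exists_toSeminorm_lt h1 h2 (show 0 < ε / (‖q‖ + 1) by positivity)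
      rw [lt_div_iff₀ (by positivity)] at hn
      have h3 : b ≤ q (c.testMap (absT (f n))) := hb ⟨n, rfl⟩
      have h4 := (le_abs_self _).trans (c.abs_apply_testMap_le q (absT (f n)))
      have h5 : c.toSeminorm (absT (f n)) ≤ c.toSeminorm (f n) := c.mono _ _ fun ω => by simp
      have h6 := apply_nonneg c.toSeminorm (f n)
      have h7 := mul_le_mul_of_nonneg_left h5 (norm_nonneg q)
      linarith

lemma ofPositive_apply (c : Capacity 𝓛) (q : StrongDual ℝ c.L1)
    (hq : ∀ φ : 𝓛.carrier, (∀ ω, 0 ≤ φ.1 ω) → 0 ≤ q (c.testMap φ)) {φ : 𝓛.carrier}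
    (hφ : ∀ ω, 0 ≤ φ.1 ω) : (c.ofPositive q hq).toSeminorm φ = q (c.testMap φ) := by
  have e : absT φ = φ := ext_apply fun ω => abs_of_nonneg (hφ ω)
  change q (c.testMap (absT φ)) = _
  rw [e]

variable [MeasurableSpace Ω] [BorelSpace Ω]

/-- A positive continuous linear form on `L¹(c)` is integration against a finite measure on the
test functions. -/
lemma exists_measure_of_positive (c : Capacity 𝓛) (q : StrongDual ℝ c.L1)
    (hq : ∀ φ : 𝓛.carrier, (∀ ω, 0 ≤ φ.1 ω) → 0 ≤ q (c.testMap φ)) :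
    ∃ μ : Measure Ω, IsFiniteMeasure μ ∧ ∀ φ : 𝓛.carrier, ∫ ω, φ.1 ω ∂μ = q (c.testMap φ) := by
  obtain ⟨μ, hfin, hμ⟩ := (c.ofPositive q hq).exists_measure_of_additive fun φ ψ hφ hψ => by
    rw [c.ofPositive_apply q hq hφ, c.ofPositive_apply q hq hψ,
      c.ofPositive_apply q hq fun ω => add_nonneg (hφ ω) (hψ ω), map_add, map_add]
  refine ⟨μ, hfin, fun φ => ?_⟩
  have h1 : ∀ ω, 0 ≤ (posT φ).1 ω := fun ω => le_max_right _ _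
  have h2 : ∀ ω, 0 ≤ (posT φ - φ).1 ω := fun ω => sub_nonneg.2 (le_max_left _ _)
  have h3 := hμ _ h1
  have h4 := hμ _ h2
  rw [c.ofPositive_apply q hq h1] at h3
  rw [c.ofPositive_apply q hq h2, testMap_sub, map_sub] at h4
  have h5 : ∫ ω, (posT φ - φ).1 ω ∂μ = ∫ ω, (posT φ).1 ω ∂μ - ∫ ω, φ.1 ω ∂μ :=
    integral_sub (integrable_test μ _) (integrable_test μ _)
  linarith

lemma lintegral_le_lsc (c : Capacity 𝓛) (q : StrongDual ℝ c.L1) (μ : Measure Ω)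
    [IsFiniteMeasure μ] (hμ : ∀ φ : 𝓛.carrier, ∫ ω, φ.1 ω ∂μ = q (c.testMap φ))
    {f : Ω → ℝ≥0∞} (hf : LowerSemicontinuous f) :
    ∫⁻ ω, f ω ∂μ ≤ ENNReal.ofReal ‖q‖ * c.lsc f := by
  have := secondCountable_of_separable_metrizable Ω
  obtain ⟨u, hu, hum, hus⟩ := exists_seq_below 𝓛 hf
  have e : ∀ ω, f ω = ⨆ n, ENNReal.ofReal ((u n).1 ω) := by
    refine fun ω => le_antisymm (le_of_forall_lt fun a ha => ?_) (iSup_le fun n => (hu n ω).2)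
    obtain ⟨b, hab, hb⟩ := exists_between ha
    rw [← ENNReal.ofReal_toReal hb.ne_top] at hab
    rw [← ENNReal.ofReal_toReal hb.ne_top] at hb
    obtain ⟨n, hn⟩ := hus ω _ hb
    exact hab.trans_le (le_iSup_of_le n (ENNReal.ofReal_le_ofReal hn))
  rw [lintegral_congr e, lintegral_iSup (fun n => (u n).1.continuous.measurable.ennreal_ofReal)
    fun m n hmn ω => ENNReal.ofReal_le_ofReal (hum ω hmn)]
  refine iSup_le fun n => ?_
  rw [← ofReal_integral_eq_lintegral_ofReal (integrable_test μ _)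
    (Eventually.of_forall fun ω => (hu n ω).1), hμ]
  calc ENNReal.ofReal (q (c.testMap (u n)))
      ≤ ENNReal.ofReal (‖q‖ * c.toSeminorm (u n)) :=
        ENNReal.ofReal_le_ofReal ((le_abs_self _).trans (c.abs_apply_testMap_le q _))
    _ = ENNReal.ofReal ‖q‖ * ENNReal.ofReal (c.toSeminorm (u n)) :=
        ENNReal.ofReal_mul (norm_nonneg _)
    _ ≤ ENNReal.ofReal ‖q‖ * c.lsc f := by
        gcongr
        exact c.le_lsc _ (hu n)

/-- The function `g` need not be measurable, and the left-hand side is its lower integral. -/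
lemma lintegral_le_ext (c : Capacity 𝓛) (q : StrongDual ℝ c.L1) (μ : Measure Ω)
    [IsFiniteMeasure μ] (hμ : ∀ φ : 𝓛.carrier, ∫ ω, φ.1 ω ∂μ = q (c.testMap φ)) (g : Ω → ℝ) :
    ∫⁻ ω, ENNReal.ofReal |g ω| ∂μ ≤ ENNReal.ofReal ‖q‖ * c.ext g := by
  unfold ext
  -- if `q = 0`, multiplication by `‖q‖` does not commute with the infimum over the majorants,
  -- which may all have capacity `∞`, but then the measure vanishes
  rcases eq_or_ne (ENNReal.ofReal ‖q‖) 0 with h0 | h0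
  · have h1 := c.lintegral_le_lsc q μ hμ (f := fun _ => ∞) lowerSemicontinuous_const
    rw [h0, zero_mul] at h1 ⊢
    exact (lintegral_mono fun ω => le_top).trans h1
  rw [ENNReal.mul_iInf_of_ne h0 ENNReal.ofReal_ne_top]
  refine le_iInf fun f => ?_
  rw [ENNReal.mul_iInf_of_ne h0 ENNReal.ofReal_ne_top]
  exact le_iInf fun hf => (lintegral_mono hf.2).trans (c.lintegral_le_lsc q μ hμ hf.1)

/-- Functions in `ℒ¹(c)` are almost everywhere limits of test functions: the lower semicontinuous
majorants of the errors have summable integrals. -/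
lemma aemeasurable_calL1 (c : Capacity 𝓛) (q : StrongDual ℝ c.L1) (μ : Measure Ω)
    [IsFiniteMeasure μ] (hμ : ∀ φ : 𝓛.carrier, ∫ ω, φ.1 ω ∂μ = q (c.testMap φ)) (g : c.CalL1) :
    AEMeasurable (fun ω => g ω) μ := by
  obtain ⟨δ, hδ, hδs⟩ := ENNReal.exists_pos_sum_of_countable (one_ne_zero (α := ℝ≥0∞)) ℕ
  choose φ hφ using fun n => g.2.2 (δ n) (ENNReal.coe_pos.2 (hδ n))
  choose k hk hkg hkl using fun n => c.exists_lsc_lt (hφ n)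
  have hfin : ∫⁻ ω, ∑' n, k n ω ∂μ ≠ ∞ := by
    rw [lintegral_tsum fun n => (hk n).measurable.aemeasurable]
    refine ne_top_of_le_ne_top (b := ENNReal.ofReal ‖q‖ * 1)
      (ENNReal.mul_ne_top ENNReal.ofReal_ne_top ENNReal.one_ne_top) ?_
    calc ∑' n, ∫⁻ ω, k n ω ∂μ ≤ ∑' n, ENNReal.ofReal ‖q‖ * (δ n : ℝ≥0∞) :=
          ENNReal.tsum_le_tsum fun n => (c.lintegral_le_lsc q μ hμ (hk n)).trans
            (by gcongr; exact (hkl n).le)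
      _ = ENNReal.ofReal ‖q‖ * ∑' n, (δ n : ℝ≥0∞) := ENNReal.tsum_mul_left
      _ ≤ ENNReal.ofReal ‖q‖ * 1 := by gcongr
  refine aemeasurable_of_tendsto_metrizable_ae' (f := fun n ω => (φ n).1 ω)
    (fun n => (φ n).1.continuous.measurable.aemeasurable) ?_
  filter_upwards [ae_lt_top (Measurable.tsum fun n => (hk n).measurable) hfin] with ω hω
  have h1 := ENNReal.tendsto_atTop_zero_of_tsum_ne_top hω.ne
  rw [tendsto_iff_edist_tendsto_0]
  refine tendsto_of_tendsto_of_tendsto_of_le_of_le tendsto_const_nhds h1 (fun _ => zero_le)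
    fun n => ?_
  dsimp only
  rw [edist_comm, edist_dist, Real.dist_eq]
  exact hkg n ω

/-- A positive continuous linear form `q` on `L¹(c)` with `q(1) = 1` is the expectation with
respect to a probability measure. -/
theorem exists_probabilityMeasure (c : Capacity 𝓛) (q : StrongDual ℝ c.L1)
    (hq : ∀ φ : 𝓛.carrier, (∀ ω, 0 ≤ φ.1 ω) → 0 ≤ q (c.testMap φ)) (h1 : q (c.constL1 1) = 1) :
    ∃ Q : ProbabilityMeasure Ω, c.InDual (Q : Measure Ω) ∧
      ∀ X : c.L1, c.expect (Q : Measure Ω) X = q X := by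
  obtain ⟨μ, hfin, hμ⟩ := c.exists_measure_of_positive q hq
  have hprob : IsProbabilityMeasure μ := by
    have h2 := hμ (constT 𝓛 1)
    rw [testMap_apply] at h2
    have h3 : μ.real Set.univ = 1 := by
      have h4 := h2.trans h1
      simpa using h4
    exact ⟨by rw [← ENNReal.toReal_eq_one_iff]; exact h3⟩
  have hint : ∀ f : c.CalL1, Integrable (fun ω => f ω) μ := by
    refine fun f => ⟨(c.aemeasurable_calL1 q μ hμ f).aestronglyMeasurable, ?_⟩
    rw [hasFiniteIntegral_iff_norm]
    exact (c.lintegral_le_ext q μ hμ f).trans_lt (ENNReal.mul_lt_top ENNReal.ofReal_lt_top f.2.1)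
  have hbound : ∀ f : c.CalL1, |∫ ω, f ω ∂μ| ≤ ‖q‖ * ‖f‖ := by
    intro f
    rw [← ENNReal.ofReal_le_ofReal_iff (by positivity), ENNReal.ofReal_mul (norm_nonneg _),
      c.ofReal_norm]
    refine le_trans ?_ (c.lintegral_le_ext q μ hμ f)
    simpa [← _root_.ofReal_norm] using enorm_integral_le_lintegral_enorm (μ := μ) (fun ω => f ω)
  have heq : ∀ f : c.CalL1, q (c.toL1 f) = ∫ ω, f ω ∂μ := by
    intro f
    rw [← sub_eq_zero, ← abs_nonpos_iff]
    refine le_of_forall_pos_le_add fun ε hε => ?_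
    have hδ : 0 < ε / (2 * (‖q‖ + 1)) := by positivity
    obtain ⟨φ, hφ⟩ := f.2.2 _ (ENNReal.ofReal_pos.2 hδ)
    have hd : ‖f - c.ofTest φ‖ < ε / (2 * (‖q‖ + 1)) := by
      rw [← ENNReal.ofReal_lt_ofReal_iff hδ, c.ofReal_norm]
      exact hφ
    have e1 : ∫ ω, f ω ∂μ = ∫ ω, (f - c.ofTest φ) ω ∂μ + q (c.testMap φ) := by
      rw [← hμ, ← integral_add (hint _) (integrable_test μ _)]
      refine integral_congr_ae (Eventually.of_forall fun ω => ?_)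
      exact (sub_add_cancel (f ω) (φ.1 ω)).symm
    have e2 : q (c.toL1 f) = q (c.toL1 (f - c.ofTest φ)) + q (c.testMap φ) := by
      rw [c.toL1_sub, map_sub, testMap_apply]
      ring
    rw [e1, e2, add_sub_add_right_eq_sub, zero_add]
    have h3 : |q (c.toL1 (f - c.ofTest φ))| ≤ ‖q‖ * ‖f - c.ofTest φ‖ := q.le_opNorm _
    have h4 := hbound (f - c.ofTest φ)
    have h5 := norm_nonneg q
    have h6 := norm_nonneg (f - c.ofTest φ)
    rw [lt_div_iff₀ (by positivity)] at hd
    refine (abs_sub _ _).trans ?_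
    nlinarith
  have hdual : c.InDual μ := ⟨hint, q, heq⟩
  refine ⟨⟨μ, hprob⟩, hdual, fun X => ?_⟩
  obtain ⟨g, rfl⟩ := c.exists_toL1 X
  exact (c.expect_toL1 hdual g).trans (heq g).symm

end

section

variable [TopologicalSpace.SeparableSpace Ω] [TopologicalSpace.MetrizableSpace Ω]

/-! ### Separability of `L¹(c)` for Prokhorov capacities -/

/-- Countably many test functions have dense restrictions to a compact set. -/
lemma exists_countable_dense_on_compact (𝓛 : TestSpace Ω) {K : Set Ω} (hK : IsCompact K) :
    ∃ D : Set 𝓛.carrier, D.Countable ∧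
      ∀ (f : 𝓛.carrier) (ε : ℝ), 0 < ε → ∃ d ∈ D, ∀ ω ∈ K, |f.1 ω - d.1 ω| < ε := by
  have := secondCountable_of_separable_metrizable Ω
  have : CompactSpace K := isCompact_iff_compactSpace.1 hK
  let r : 𝓛.carrier → C(K, ℝ) := fun f => f.1.toContinuousMap.restrict K
  obtain ⟨t, htr, htc, htd⟩ := (TopologicalSpace.IsSeparable.of_separableSpace
    (Set.range r)).exists_countable_dense_subset
  obtain ⟨D, rfl, hD⟩ := Set.exists_image_eq_injOn_of_subset_range htr
  refine ⟨D, Set.countable_of_injective_of_countable_image hD htc, fun f ε hε => ?_⟩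
  obtain ⟨_, ⟨d, hd, rfl⟩, hdf⟩ := Metric.mem_closure_iff.1 (htd ⟨f, rfl⟩) ε hε
  refine ⟨d, hd, fun ω hω => ?_⟩
  exact (ContinuousMap.dist_apply_le_dist (f := r f) (g := r d) ⟨ω, hω⟩).trans_lt hdf

/-- For a Prokhorov capacity, truncations of test functions taken from countable families that are
dense on suitable compact sets are dense in `L¹(c)`. -/
lemma separableSpace_L1 {c : Capacity 𝓛} (hc : c.IsProkhorov) :
    TopologicalSpace.SeparableSpace c.L1 := by
  choose K hK hKc using fun n : ℕ => hc (1 / ((n : ℝ) + 1)) (by positivity)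
  choose D hDc hD using fun n => exists_countable_dense_on_compact 𝓛 (hK n)
  let S : Set 𝓛.carrier := ⋃ n, ⋃ m : ℕ, (fun f => truncT f m) '' D n
  have hS : S.Countable := Set.countable_iUnion fun n => Set.countable_iUnion fun m =>
    (hDc n).image _
  refine ⟨⟨c.testMap '' S, hS.image _, ?_⟩⟩
  -- a test function that is small on `K n` and bounded by `2 m` is small in `L¹(c)`
  have key : ∀ (f : 𝓛.carrier) (ε : ℝ), 0 < ε → ∃ d ∈ S, c.toSeminorm (f - d) < ε := by
    intro f ε hε
    obtain ⟨m, hm⟩ := exists_nat_gt ‖f.1‖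
    obtain ⟨δ, hδ, hδε⟩ : ∃ δ : ℝ, 0 < δ ∧ δ * c.toSeminorm (constT 𝓛 1) < ε / 2 := by
      have h0 := apply_nonneg c.toSeminorm (constT 𝓛 1)
      refine ⟨ε / 2 / (c.toSeminorm (constT 𝓛 1) + 1), by positivity, ?_⟩
      rw [div_mul_eq_mul_div, div_lt_iff₀ (by positivity)]
      nlinarith
    obtain ⟨n, hn⟩ := exists_nat_gt (2 * (2 * m + 1) / ε)
    obtain ⟨d, hd, hdf⟩ := hD n f δ hδ
    refine ⟨truncT d m, Set.mem_iUnion₂.2 ⟨n, m, d, hd, rfl⟩, ?_⟩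
    have hf : ∀ ω, |f.1 ω| ≤ m := fun ω => (f.1.norm_coe_le_norm ω).trans hm.le
    have hm0 : (0 : ℝ) ≤ m := m.cast_nonneg
    have hsmall : ∀ ω ∈ K n, |f.1 ω - (truncT d m).1 ω| ≤ δ := by
      intro ω hω
      have h1 := abs_le.1 (hf ω)
      have e : f.1 ω = max (min (f.1 ω) m) (-m) := by
        rw [min_eq_left h1.2, max_eq_left h1.1]
      rw [truncT_apply, e]
      exact ((abs_max_sub_max_le_abs _ _ _).trans (abs_inf_sub_inf_le_abs _ _ _)).trans
        (hdf ω hω).le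
    have hbig : ∀ ω, |f.1 ω - (truncT d m).1 ω| ≤ 2 * m + 1 := by
      intro ω
      have h1 := abs_le.1 (hf ω)
      have h2 : (truncT d m).1 ω ≤ m := by
        rw [truncT_apply]
        exact max_le (min_le_right _ _) (by linarith)
      have h3 : -(m : ℝ) ≤ (truncT d m).1 ω := le_max_right _ _
      rw [abs_le]
      constructor <;> linarith
    set g : 𝓛.carrier := f - truncT d m
    have hgω : ∀ ω, g.1 ω = f.1 ω - (truncT d m).1 ω := fun ω => rfl
    let w : 𝓛.carrier := posT (absT g - δ • constT 𝓛 1)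
    have hw : ∀ ω, w.1 ω = max (|g.1 ω| - δ) 0 := by
      intro ω
      change max (|g.1 ω| - δ * 1) 0 = _
      rw [mul_one]
    have hA : (0 : ℝ) < 2 * m + 1 := by positivity
    have h1 : c.toSeminorm ((2 * (m : ℝ) + 1)⁻¹ • w) ≤ 1 / ((n : ℝ) + 1) := by
      refine hKc n _ fun ω => ?_
      have e : ((2 * (m : ℝ) + 1)⁻¹ • w).1 ω = (2 * (m : ℝ) + 1)⁻¹ * w.1 ω := rfl
      rw [e, hw, abs_of_nonneg (mul_nonneg (by positivity) (le_max_right _ _)), hgω]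
      by_cases hω : ω ∈ K n
      · rw [max_eq_right (by linarith [hsmall ω hω]), mul_zero]
        exact Set.indicator_nonneg (fun _ _ => zero_le_one) _
      · rw [Set.indicator_of_mem hω, inv_mul_le_iff₀ hA, mul_one]
        exact max_le (by linarith [hbig ω]) hA.le
    rw [map_smul_eq_mul, Real.norm_of_nonneg (by positivity), inv_mul_le_iff₀ hA] at h1
    have h2 : c.toSeminorm g ≤ δ * c.toSeminorm (constT 𝓛 1) + c.toSeminorm w := by
      have e0 : c.toSeminorm (δ • constT 𝓛 1) = δ * c.toSeminorm (constT 𝓛 1) := by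
        rw [map_smul_eq_mul, Real.norm_of_nonneg hδ.le]
      rw [← e0]
      refine (c.mono g (δ • constT 𝓛 1 + w) fun ω => ?_).trans (map_add_le_add _ _ _)
      have e : (δ • constT 𝓛 1 + w).1 ω = δ * 1 + w.1 ω := rfl
      rw [e, hw]
      refine le_trans ?_ (le_abs_self _)
      linarith [le_max_left (|g.1 ω| - δ) 0]
    have h3 : (2 * (m : ℝ) + 1) * (1 / ((n : ℝ) + 1)) < ε / 2 := by
      rw [div_lt_iff₀ hε] at hn
      rw [mul_one_div, div_lt_iff₀ (by positivity)]
      nlinarith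
    linarith
  intro X
  rw [Metric.mem_closure_iff]
  intro ε hε
  obtain ⟨g, rfl⟩ := c.exists_toL1 X
  obtain ⟨φ, hφ⟩ := g.2.2 _ (ENNReal.ofReal_pos.2 (half_pos hε))
  obtain ⟨d, hd, hdφ⟩ := key φ _ (half_pos hε)
  refine ⟨_, ⟨d, hd, rfl⟩, ?_⟩
  have h1 : dist (c.toL1 g) (c.testMap φ) < ε / 2 := by
    rw [dist_eq_norm, testMap_apply, ← c.toL1_sub, c.norm_toL1,
      ← ENNReal.ofReal_lt_ofReal_iff (half_pos hε), c.ofReal_norm]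
    exact hφ
  have h2 : dist (c.testMap φ) (c.testMap d) < ε / 2 := by
    rw [dist_eq_norm, ← testMap_sub, norm_testMap]
    exact hdφ
  linarith [dist_triangle (c.toL1 g) (c.testMap φ) (c.testMap d)]

/-! ### The dual representation -/

/-- A subgradient of a convex risk measure is `-q` with `q` positive and `q(1) = 1`, hence comes
from a probability measure. -/
lemma IsConvexRiskMeasure.exists_supporting_measure [MeasurableSpace Ω] [BorelSpace Ω]
    {c : Capacity 𝓛} {ρ : c.L1 → ℝ} (hρ : c.IsConvexRiskMeasure ρ) (X : c.L1) :
    ∃ (Q : ProbabilityMeasure Ω) (q : StrongDual ℝ c.L1), c.InDual (Q : Measure Ω) ∧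
      (∀ Y, c.expect (Q : Measure Ω) Y = q Y) ∧ ∀ Y, ρ X - q (Y - X) ≤ ρ Y := by
  obtain ⟨l, hl⟩ := exists_subgradient hρ.convexOn hρ.continuous X
  have hpos : ∀ φ : 𝓛.carrier, (∀ ω, 0 ≤ φ.1 ω) → 0 ≤ (-l) (c.testMap φ) := by
    intro φ hφ
    have h1 := hl (X + c.testMap φ)
    have h2 : ρ (X + c.testMap φ) ≤ ρ X := by
      refine hρ.monotonic _ _ ?_
      rw [add_sub_cancel_left]
      exact c.isNonneg_toL1 _ hφ
    rw [add_sub_cancel_left] at h1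
    rw [neg_apply]
    linarith
  have hone : (-l) (c.constL1 1) = 1 := by
    have h1 := hl (X + c.constL1 1)
    have h2 := hl (X - c.constL1 1)
    have h3 := hρ.translation X 1
    have h4 := hρ.translation (X - c.constL1 1) 1
    rw [sub_add_cancel] at h4
    rw [add_sub_cancel_left] at h1
    rw [sub_sub_cancel_left, map_neg] at h2
    rw [neg_apply]
    linarith
  obtain ⟨Q, hQ, hQe⟩ := c.exists_probabilityMeasure (-l) hpos hone
  refine ⟨Q, -l, hQ, hQe, fun Y => ?_⟩
  rw [neg_apply, sub_neg_eq_add]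
  exact hl Y

end

end Capacity

end RiskCapacity

end

theorem mainTheorem2 {Ω : Type*} [TopologicalSpace Ω] [TopologicalSpace.SeparableSpace Ω]
    [TopologicalSpace.MetrizableSpace Ω] [MeasurableSpace Ω] [BorelSpace Ω]
    (𝓛 : RiskCapacity.TestSpace Ω) (c : RiskCapacity.Capacity 𝓛) (hc : c.IsProkhorov)
    (ρ : c.L1 → ℝ) (hρ : c.IsConvexRiskMeasure ρ) :
    ∃ R : ℕ → ProbabilityMeasure Ω, (∀ n, c.InDual (R n : Measure Ω)) ∧
      ∀ X : c.L1, (ρ X : EReal) =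
        ⨆ n, ((c.expect (R n : Measure Ω) (-X) : EReal) - c.penalty ρ (R n : Measure Ω)) := by
  have := RiskCapacity.Capacity.separableSpace_L1 hc
  let x : ℕ → c.L1 := TopologicalSpace.denseSeq c.L1
  choose R q hR hq hsub using fun n => hρ.exists_supporting_measure (x n)
  have hpen : ∀ n, c.penalty ρ (R n : Measure Ω) = ((-q n (x n) - ρ (x n) : ℝ) : EReal) := by
    intro n
    refine le_antisymm (iSup_le fun Y => EReal.coe_le_coe_iff.2 ?_) ?_
    · have := hsub n Y
      rw [map_sub] at this
      rw [hq, map_neg]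
      linarith
    · refine le_iSup_of_le (x n) (EReal.coe_le_coe_iff.2 ?_)
      rw [hq, map_neg]
  refine ⟨R, hR, fun X => ?_⟩
  have hterm : ∀ n, ((c.expect (R n : Measure Ω) (-X) : EReal) - c.penalty ρ (R n : Measure Ω)) =
      ((ρ (x n) - q n (X - x n) : ℝ) : EReal) := by
    intro n
    rw [hpen, hq, map_neg, map_sub, ← EReal.coe_sub]
    congr 1
    ring
  simp_rw [hterm]
  refine le_antisymm ?_ (iSup_le fun n => EReal.coe_le_coe_iff.2 (hsub n X))
  -- reflecting `X` in `x n` gives `q n (X - x n) ≤ ρ (2 • x n - X) - ρ (x n)`, which is small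
  -- when `x n` is close to `X`
  refine EReal.ge_of_forall_gt_iff_ge.1 fun r hr => ?_
  have hr' : 2 * ρ X - ρ ((2 : ℝ) • X - X) > r := by
    have := EReal.coe_lt_coe_iff.1 hr
    rw [two_smul, add_sub_cancel_right]
    linarith
  have hcont : Continuous fun Y : c.L1 => 2 * ρ Y - ρ ((2 : ℝ) • Y - X) :=
    (hρ.continuous.const_mul 2).sub (hρ.continuous.comp (by fun_prop))
  obtain ⟨n, hn⟩ := (TopologicalSpace.denseRange_denseSeq c.L1).exists_mem_open
    (isOpen_lt continuous_const hcont) ⟨X, hr'⟩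
  refine le_iSup_of_le n (EReal.coe_le_coe_iff.2 ?_)
  have h1 := hsub n ((2 : ℝ) • x n - X)
  have e : (2 : ℝ) • x n - X - x n = -(X - x n) := by rw [two_smul]; abel
  rw [e, map_neg] at h1
  have h2 : r < 2 * ρ (x n) - ρ ((2 : ℝ) • x n - X) := hn
  linarith
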